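/- Let $\Bbbk$ be a field, $A$ a commutative associative unital $\Bbbk$-algebra, $S$ a set and $a_S\colon S\to \operatorname{Der}_\Bbbk(A)$ a map. Let $\operatorname{Lie}_{\Bbbk,S}$ be the free $\Bbbk$-Lie algebra over $S$, and write again $a_S\colon \operatorname{Lie}_{\Bbbk,S}\to\operatorname{Der}_\Bbbk(A)$ for the induced morphism of Lie algebras. The free $(\Bbbk,A)$-Lie–Rinehart algebra over $(S,a_S)$ is the $A$-module $L_{A,S}=A\otimes_\Bbbk\operatorname{Lie}_{\Bbbk,S}$ with anchor $a(\alpha\otimes\xi)(\beta)=\alpha\,a_S(\xi)(\beta)$ and bracket $$[\alpha\otimes\xi,\beta\otimes\eta]=\alpha\beta\otimes[\xi,\eta]+\alpha\,a_S(\xi)(\beta)\otimes\eta-\beta\,a_S(\eta)(\alpha)\otimes\xi .$$ For a $(\Bbbk,A)$-Lie–Rinehart algebra $(L,a)$, let $\mathfrak U(L)$ be its universal enveloping algebra, i.e. the universal unital associative $\Bbbk$-algebra with a $\Bbbk$-algebra homomorphism $\imath\colon A\to\mathfrak U(L)$ and a map of $\Bbbk$-Lie algebras $\jmath\colon L\to\mathfrak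 U(L)$ such that $\jmath(\alpha x)=\imath(\alpha)\jmath(x)$ and $[\jmath(x),\imath(\alpha)]=\imath(a(x)(\alpha))$ for $\alpha\in A$, $x\in L$. Let $\bar a\colon\mathfrak U(L)\to\operatorname{End}_\Bbbk(A)$ be the algebra homomorphism under which $A$ acts by multiplication and $L$ acts through the anchor; the augmentation ideal of $\mathfrak U(L)$ is the left ideal $\ker\varepsilon$, where $\varepsilon\colon\mathfrak U(L)\to A$, $\varepsilon(u)=\bar a(u)(1)$. A representation of $L$ is an $A$-module $M$ with an action of the Lie algebra $L$ such that $(\alpha x)m=\alpha(xm)$ and $x(\alpha m)=\alpha(xm)+a(x)(\alpha)m$. For such an $M$, $H^i(L;M)$ denotes the $i$-th cohomology of the Chevalley–Eilenberg complex whose degree $p$ term is the space of alternating $A$-multilinear maps $L^p\to M$, with differential $$(d\omega)(x_1,\dots,x_{p+1})=\sum_{i}(-1)^{i-1}x_i\,\omega(\dots,\hat x_i,\dots)+\sum_{i<j}(-1)^{i+j}\omega([x_i,x_j],\dots,\hat x_i,\dots,\hat x_j,\dots).$$ Proposition. The augmentation ideal $K_{A,S}$ of $\mathfrak U(L_{A,S})$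 is a free left $\mathfrak U(L_{A,S})$-module. Moreover $H^i(L_{A,S};M)=0$ for every $i\ge 2$ and every representation $M$ of $L_{A,S}$. -/

import Mathlib

open scoped TensorProduct

namespace LieRinehart

/-! ### Transformation and free Lie–Rinehart algebras -/

section Transformation

variable {k A 𝔤 : Type*} [CommRing k] [CommRing A] [Algebra k A] [LieRing 𝔤] [LieAlgebra k 𝔤]

/-- The `A`-module `A ⊗[k] 𝔤` underlying the transformation Lie–Rinehart algebra of a Lie algebra
`𝔤` acting on `A` through `ρ : 𝔤 → Der_k(A)`. It is a type synonym, so that it does not carry the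
`A`-bilinear bracket of the extension of scalars. -/
@[nolint unusedArguments]
def Transformation (_ρ : 𝔤 →ₗ⁅k⁆ Derivation k A A) : Type _ := A ⊗[k] 𝔤

namespace Transformation

variable (ρ : 𝔤 →ₗ⁅k⁆ Derivation k A A)

noncomputable instance : AddCommGroup (Transformation ρ) :=
  inferInstanceAs (AddCommGroup (A ⊗[k] 𝔤))

noncomputable instance : Module A (Transformation ρ) :=
  inferInstanceAs (Module A (A ⊗[k] 𝔤))

noncomputable instance : Module k (Transformation ρ) :=
  inferInstanceAs (Module k (A ⊗[k] 𝔤))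

instance : IsScalarTower k A (Transformation ρ) :=
  inferInstanceAs (IsScalarTower k A (A ⊗[k] 𝔤))

/-- The pure tensor `α ⊗ ξ` as an element of the transformation Lie–Rinehart algebra. -/
noncomputable def tmul (α : A) (ξ : 𝔤) : Transformation ρ := α ⊗ₜ[k] ξ

/-- The anchor `α ⊗ ξ ↦ α ρ(ξ)`. -/
noncomputable def anchorMap : A ⊗[k] 𝔤 →ₗ[A] Derivation k A A :=
  LinearMap.liftBaseChange A (ρ : 𝔤 →ₗ[k] Derivation k A A)

theorem anchorMap_tmul (α : A) (ξ : 𝔤) : anchorMap ρ (α ⊗ₜ ξ) = α • ρ ξ := by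
  simp [anchorMap]

/-- A derivation of `A` acting on `A ⊗[k] 𝔤` through the first factor. -/
noncomputable def act : Derivation k A A →ₗ[k] A ⊗[k] 𝔤 →ₗ[k] A ⊗[k] 𝔤 where
  toFun D := (D : A →ₗ[k] A).rTensor 𝔤
  map_add' D E := by simp [LinearMap.rTensor_add]
  map_smul' c D := by simp [LinearMap.rTensor_smul]

theorem act_tmul (D : Derivation k A A) (α : A) (ξ : 𝔤) :
    act D (α ⊗ₜ[k] ξ) = D α ⊗ₜ ξ := by
  simp [act]

theorem act_smul (D : Derivation k A A) (α : A) (y : A ⊗[k] 𝔤) :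
    act D (α • y) = α • act D y + D α • y := by
  induction y with
  | zero => simp
  | tmul β ξ => simp [act_tmul, TensorProduct.smul_tmul', TensorProduct.add_tmul, mul_comm]
  | add y z hy hz => rw [smul_add, map_add, hy, hz, map_add]; module

theorem smul_act (α : A) (D : Derivation k A A) (y : A ⊗[k] 𝔤) :
    act (α • D) y = α • act D y := by
  induction y with
  | zero => simp
  | tmul β ξ => simp [act_tmul, TensorProduct.smul_tmul']
  | add y z hy hz => rw [map_add, hy, hz, map_add, smul_add]

theorem act_commutator (D E : Derivation k A A) (y : A ⊗[k] 𝔤) :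
    act ⁅D, E⁆ y = act D (act E y) - act E (act D y) := by
  induction y with
  | zero => simp
  | tmul β ξ => simp [act_tmul, Derivation.commutator_apply, TensorProduct.sub_tmul]
  | add y z hy hz => simp only [map_add, hy, hz]; abel

theorem act_lie (D : Derivation k A A) (y z : A ⊗[k] 𝔤) :
    act D ⁅y, z⁆ = ⁅act D y, z⁆ + ⁅y, act D z⁆ := by
  induction y with
  | zero => simp
  | add y y' hy hy' => simp only [map_add, add_lie, hy, hy']; abel
  | tmul β ξ =>
    induction z with
    | zero => simp
    | add z z' hz hz' => simp only [map_add, lie_add, hz, hz']; abel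
    | tmul γ η =>
      simp only [act_tmul, LieAlgebra.ExtendScalars.bracket_tmul, Derivation.leibniz,
        smul_eq_mul, ← TensorProduct.add_tmul]
      congr 1; ring

/-- The bracket: the `A`-bilinear extension of the bracket of `𝔤`, corrected by the two terms
in which the anchor of one element differentiates the coefficients of the other. -/
noncomputable def bracketMap (x y : A ⊗[k] 𝔤) : A ⊗[k] 𝔤 :=
  ⁅x, y⁆ + act (anchorMap ρ x) y - act (anchorMap ρ y) x

theorem anchorMap_act (D : Derivation k A A) (α : A) (ξ : 𝔤) :
    anchorMap ρ (act D (α ⊗ₜ ξ)) = D α • ρ ξ := by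
  rw [act_tmul, anchorMap_tmul]

theorem anchorMap_bracketMap (x y : A ⊗[k] 𝔤) :
    anchorMap ρ (bracketMap ρ x y) = ⁅anchorMap ρ x, anchorMap ρ y⁆ := by
  induction x with
  | zero => simp [bracketMap]
  | add x x' hx hx' =>
    simp only [bracketMap, map_add, map_sub, add_lie, LinearMap.add_apply] at hx hx' ⊢
    rw [← hx, ← hx']; abel
  | tmul α ξ =>
    induction y with
    | zero => simp [bracketMap]
    | add y y' hy hy' =>
      simp only [bracketMap, map_add, map_sub, lie_add, LinearMap.add_apply] at hy hy' ⊢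
      rw [← hy, ← hy']; abel
    | tmul β η =>
      ext c
      simp only [bracketMap, map_add, map_sub, anchorMap_act, anchorMap_tmul,
        LieAlgebra.ExtendScalars.bracket_tmul, LieHom.map_lie, Derivation.commutator_apply,
        Derivation.add_apply, Derivation.sub_apply, Derivation.smul_apply, Derivation.leibniz,
        smul_eq_mul]
      ring

theorem bracketMap_add_left (x y z : A ⊗[k] 𝔤) :
    bracketMap ρ (x + y) z = bracketMap ρ x z + bracketMap ρ y z := by
  simp only [bracketMap, map_add, add_lie, LinearMap.add_apply]
  abel

theorem bracketMap_add_right (x y z : A ⊗[k] 𝔤) :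
    bracketMap ρ x (y + z) = bracketMap ρ x y + bracketMap ρ x z := by
  simp only [bracketMap, map_add, lie_add, LinearMap.add_apply]
  abel

theorem bracketMap_self (x : A ⊗[k] 𝔤) : bracketMap ρ x x = 0 := by
  simp [bracketMap]

theorem bracketMap_jacobi (x y z : A ⊗[k] 𝔤) :
    bracketMap ρ x (bracketMap ρ y z) =
      bracketMap ρ (bracketMap ρ x y) z + bracketMap ρ y (bracketMap ρ x z) := by
  rw [bracketMap, anchorMap_bracketMap, bracketMap.eq_def ρ (bracketMap ρ x y),
    anchorMap_bracketMap, bracketMap.eq_def ρ y (bracketMap ρ x z), anchorMap_bracketMap]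
  simp only [bracketMap, map_add, map_sub, act_lie, act_commutator, lie_add, lie_sub, add_lie,
    sub_lie]
  rw [leibniz_lie x y z, ← lie_skew (act (anchorMap ρ z) x) y]
  abel

theorem bracketMap_smul_right (x y : A ⊗[k] 𝔤) (α : A) :
    bracketMap ρ x (α • y) = α • bracketMap ρ x y + anchorMap ρ x α • y := by
  rw [bracketMap, bracketMap, act_smul, map_smul, smul_act, lie_smul]
  module

theorem anchorMap_jacobi (x y : A ⊗[k] 𝔤) (α : A) :
    anchorMap ρ x (anchorMap ρ y α) =
      anchorMap ρ (bracketMap ρ x y) α + anchorMap ρ y (anchorMap ρ x α) := by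
  rw [anchorMap_bracketMap, Derivation.commutator_apply]; abel

theorem anchorMap_mul (x : A ⊗[k] 𝔤) (α β : A) :
    anchorMap ρ x (α * β) = α • anchorMap ρ x β + anchorMap ρ x α * β := by
  rw [Derivation.leibniz, smul_eq_mul, smul_eq_mul, mul_comm β]

noncomputable instance : LieRing (Transformation ρ) where
  bracket x y := bracketMap ρ x y
  add_lie := bracketMap_add_left ρ
  lie_add := bracketMap_add_right ρ
  lie_self := bracketMap_self ρ
  leibniz_lie := bracketMap_jacobi ρ

noncomputable instance : LieRingModule (Transformation ρ) A where
  bracket x α := anchorMap ρ x α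
  add_lie x y α := congrArg (fun D : Derivation k A A => D α) ((anchorMap ρ).map_add x y)
  lie_add x α β := (anchorMap ρ x).map_add α β
  leibniz_lie := anchorMap_jacobi ρ

instance : LieRinehartRing A (Transformation ρ) where
  lie_smul_eq_mul' α β x :=
    congrArg (fun D : Derivation k A A => D β) ((anchorMap ρ).map_smul α x)
  leibniz_mul_right' := anchorMap_mul ρ
  leibniz_smul_right' := bracketMap_smul_right ρ

theorem lie_algebraMap (c : k) (x : Transformation ρ) : ⁅x, algebraMap k A c⁆ = 0 :=
  (anchorMap ρ x).map_algebraMap c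

noncomputable instance : LieAlgebra k (Transformation ρ) where
  lie_smul c x y := by
    rw [← algebraMap_smul A c y, LieRinehartRing.leibniz_smul_right, lie_algebraMap, zero_smul,
      add_zero, algebraMap_smul]

instance : LieRinehartAlgebra k A (Transformation ρ) where
  smul_lie c x α := by
    rw [← algebraMap_smul A c x, LieRinehartRing.lie_smul_eq_mul, Algebra.smul_def]
  lie_smul c x α := (anchorMap ρ x).map_smul c α

theorem tmul_lie_tmul (α β : A) (ξ η : 𝔤) :
    ⁅tmul ρ α ξ, tmul ρ β η⁆ =
      tmul ρ (α * β) ⁅ξ, η⁆ + tmul ρ (α * ρ ξ β) η - tmul ρ (β * ρ η α) ξ := by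
  change bracketMap ρ (α ⊗ₜ ξ) (β ⊗ₜ η) = _
  simp only [bracketMap, anchorMap_tmul, act_tmul]
  rfl

theorem tmul_lie (α β : A) (ξ : 𝔤) : ⁅tmul ρ α ξ, β⁆ = α * ρ ξ β := by
  change anchorMap ρ (α ⊗ₜ ξ) β = _
  simp [anchorMap_tmul]

end Transformation

end Transformation

/-- The free `(k, A)`-Lie–Rinehart algebra over a set `S` equipped with a map `a : S → Der_k(A)`:
the transformation Lie–Rinehart algebra `A ⊗[k] Lie(S)` of the free Lie algebra on `S`, acting on
`A` through the unique extension of `a` to a morphism of Lie algebras. -/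
abbrev FreeLieRinehart {k A S : Type*} [CommRing k] [CommRing A] [Algebra k A]
    (a : S → Derivation k A A) : Type _ :=
  Transformation (FreeLieAlgebra.lift k a)

/-! ### The universal enveloping algebra and its augmentation ideal -/

section Enveloping

variable (k A L : Type*) [CommRing k] [CommRing A] [Algebra k A] [LieRing L] [Module A L]
  [LieRingModule L A]

/-- The defining relations of the universal enveloping algebra, between words in the letters
`α ∈ A` and `x ∈ L`: the letters of `A` form a copy of the `k`-algebra `A`, the letters of `L` form
a copy of the `A`-module `L`, commutators of letters of `L` are brackets, and
`x α - α x = a(x)(α)`, where `a` is the anchor. -/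
inductive EnvelopingRel : FreeAlgebra k (A ⊕ L) → FreeAlgebra k (A ⊕ L) → Prop
  | algebraMap (c : k) :
      EnvelopingRel (FreeAlgebra.ι k (Sum.inl (algebraMap k A c))) (algebraMap k _ c)
  | add (α β : A) :
      EnvelopingRel (FreeAlgebra.ι k (Sum.inl (α + β)))
        (FreeAlgebra.ι k (Sum.inl α) + FreeAlgebra.ι k (Sum.inl β))
  | mul (α β : A) :
      EnvelopingRel (FreeAlgebra.ι k (Sum.inl (α * β)))
        (FreeAlgebra.ι k (Sum.inl α) * FreeAlgebra.ι k (Sum.inl β))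
  | lie_add (x y : L) :
      EnvelopingRel (FreeAlgebra.ι k (Sum.inr (x + y)))
        (FreeAlgebra.ι k (Sum.inr x) + FreeAlgebra.ι k (Sum.inr y))
  | lie_smul (α : A) (x : L) :
      EnvelopingRel (FreeAlgebra.ι k (Sum.inr (α • x)))
        (FreeAlgebra.ι k (Sum.inl α) * FreeAlgebra.ι k (Sum.inr x))
  | lie_lie (x y : L) :
      EnvelopingRel (FreeAlgebra.ι k (Sum.inr ⁅x, y⁆))
        (FreeAlgebra.ι k (Sum.inr x) * FreeAlgebra.ι k (Sum.inr y) -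
          FreeAlgebra.ι k (Sum.inr y) * FreeAlgebra.ι k (Sum.inr x))
  | anchor (x : L) (α : A) :
      EnvelopingRel (FreeAlgebra.ι k (Sum.inl ⁅x, α⁆))
        (FreeAlgebra.ι k (Sum.inr x) * FreeAlgebra.ι k (Sum.inl α) -
          FreeAlgebra.ι k (Sum.inl α) * FreeAlgebra.ι k (Sum.inr x))

/-- The universal enveloping algebra `U(L)` of a `(k, A)`-Lie–Rinehart algebra `L`. -/
abbrev Enveloping : Type _ := RingQuot (EnvelopingRel k A L)

namespace Enveloping

/-- The canonical homomorphism of `k`-algebras `A → U(L)`. -/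
noncomputable def ofBase : A →ₐ[k] Enveloping k A L :=
  AlgHom.ofLinearMap
    { toFun := fun α => RingQuot.mkAlgHom k (EnvelopingRel k A L) (FreeAlgebra.ι k (Sum.inl α))
      map_add' := fun α β => by
        rw [RingQuot.mkAlgHom_rel k (EnvelopingRel.add α β), map_add]
      map_smul' := fun c α => by
        rw [Algebra.smul_def, RingQuot.mkAlgHom_rel k (EnvelopingRel.mul _ α), map_mul,
          RingQuot.mkAlgHom_rel k (EnvelopingRel.algebraMap c), AlgHom.commutes, RingHom.id_apply,
          Algebra.smul_def] }
    (by
      change RingQuot.mkAlgHom k (EnvelopingRel k A L) (FreeAlgebra.ι k (Sum.inl 1)) = 1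
      rw [← map_one (algebraMap k A), RingQuot.mkAlgHom_rel k (EnvelopingRel.algebraMap 1),
        map_one, map_one])
    (fun α β => by
      change RingQuot.mkAlgHom k (EnvelopingRel k A L) (FreeAlgebra.ι k (Sum.inl (α * β))) = _
      rw [RingQuot.mkAlgHom_rel k (EnvelopingRel.mul α β), map_mul]
      rfl)

/-- The canonical map `L → U(L)`. -/
noncomputable def of (x : L) : Enveloping k A L :=
  RingQuot.mkAlgHom k (EnvelopingRel k A L) (FreeAlgebra.ι k (Sum.inr x))

theorem of_add (x y : L) : of k A L (x + y) = of k A L x + of k A L y := by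
  rw [of, RingQuot.mkAlgHom_rel k (EnvelopingRel.lie_add x y), map_add]; rfl

theorem of_smul (α : A) (x : L) : of k A L (α • x) = ofBase k A L α * of k A L x := by
  rw [of, RingQuot.mkAlgHom_rel k (EnvelopingRel.lie_smul α x), map_mul]; rfl

theorem of_lie (x y : L) :
    of k A L ⁅x, y⁆ = of k A L x * of k A L y - of k A L y * of k A L x := by
  rw [of, RingQuot.mkAlgHom_rel k (EnvelopingRel.lie_lie x y), map_sub, map_mul, map_mul]; rfl

theorem ofBase_lie (x : L) (α : A) :
    ofBase k A L ⁅x, α⁆ = of k A L x * ofBase k A L α - ofBase k A L α * of k A L x := by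
  change RingQuot.mkAlgHom k (EnvelopingRel k A L) (FreeAlgebra.ι k (Sum.inl ⁅x, α⁆)) = _
  rw [RingQuot.mkAlgHom_rel k (EnvelopingRel.anchor x α), map_sub, map_mul, map_mul]; rfl

variable {k A L}

/-- The universal property of `U(L)`, existence. -/
noncomputable def lift {B : Type*} [Ring B] [Algebra k B] (i : A →ₐ[k] B) (j : L → B)
    (hadd : ∀ x y, j (x + y) = j x + j y) (hsmul : ∀ (α : A) (x : L), j (α • x) = i α * j x)
    (hlie : ∀ x y, j ⁅x, y⁆ = j x * j y - j y * j x)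
    (hanchor : ∀ (x : L) (α : A), i ⁅x, α⁆ = j x * i α - i α * j x) :
    Enveloping k A L →ₐ[k] B :=
  RingQuot.liftAlgHom k ⟨FreeAlgebra.lift k (Sum.elim i j), by
    intro u v h
    induction h <;> simp [*]⟩

section

variable {B : Type*} [Ring B] [Algebra k B] (i : A →ₐ[k] B) (j : L → B)
    (hadd : ∀ x y, j (x + y) = j x + j y) (hsmul : ∀ (α : A) (x : L), j (α • x) = i α * j x)
    (hlie : ∀ x y, j ⁅x, y⁆ = j x * j y - j y * j x)
    (hanchor : ∀ (x : L) (α : A), i ⁅x, α⁆ = j x * i α - i α * j x)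

@[simp]
theorem lift_ofBase (α : A) :
    lift i j hadd hsmul hlie hanchor (ofBase k A L α) = i α := by
  change RingQuot.liftAlgHom k _ (RingQuot.mkAlgHom k _ _) = _
  rw [RingQuot.liftAlgHom_mkAlgHom_apply, FreeAlgebra.lift_ι_apply, Sum.elim_inl]

@[simp]
theorem lift_of (x : L) : lift i j hadd hsmul hlie hanchor (of k A L x) = j x := by
  rw [lift, of, RingQuot.liftAlgHom_mkAlgHom_apply, FreeAlgebra.lift_ι_apply, Sum.elim_inr]

/-- The universal property of `U(L)`, uniqueness. -/
theorem hom_ext {f g : Enveloping k A L →ₐ[k] B}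
    (hA : ∀ α, f (ofBase k A L α) = g (ofBase k A L α))
    (hL : ∀ x, f (of k A L x) = g (of k A L x)) : f = g := by
  apply RingQuot.ringQuot_ext'
  apply FreeAlgebra.hom_ext
  funext s
  cases s with
  | inl α => exact hA α
  | inr x => exact hL x

end

end Enveloping

variable [LieRinehartRing A L] [LieAlgebra k L] [LieRinehartAlgebra k A L]

/-- The extension `U(L) → End_k(A)` of the anchor of `L`: an element of `A` acts by
multiplication, an element of `L` acts through the anchor. -/
noncomputable def anchorHom : Enveloping k A L →ₐ[k] Module.End k A :=
  Enveloping.lift (Algebra.lmul k A) (fun x => LieModule.toEnd k L A x)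
    (fun x y => map_add _ x y)
    (fun α x => by ext β; simp)
    (fun x y => by ext β; simp)
    (fun x α => by ext β; simp)

/-- The augmentation `ε : U(L) → A`, `ε(u) = ā(u)(1)`, where `ā : U(L) → End_k(A)` extends the
anchor. -/
noncomputable def augmentation : Enveloping k A L →ₗ[k] A :=
  (LinearMap.applyₗ (1 : A)).comp (anchorHom k A L).toLinearMap

/-- The augmentation ideal `K = ker ε`, a left ideal of `U(L)`. -/
noncomputable def augmentationIdeal : Submodule (Enveloping k A L) (Enveloping k A L) where
  carrier := {u | augmentation k A L u = 0}
  add_mem' {u v} hu hv := by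
    have hu' : augmentation k A L u = 0 := hu
    have hv' : augmentation k A L v = 0 := hv
    change augmentation k A L (u + v) = 0
    rw [map_add, hu', hv', add_zero]
  zero_mem' := map_zero _
  smul_mem' u v hv := by
    have hv' : anchorHom k A L v 1 = 0 := hv
    change anchorHom k A L (u * v) 1 = 0
    rw [map_mul, Module.End.mul_apply, hv', map_zero]

end Enveloping

/-! ### Representations and cohomology -/

/-- A representation of a Lie–Rinehart algebra `L` over `A`: an `A`-module `M` with an action of
the Lie ring `L` that is `A`-linear in `L` and satisfies `x (α m) = α (x m) + a(x)(α) m`, where `a`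
is the anchor. -/
class Representation (A L M : Type*) [CommRing A] [LieRing L] [Module A L] [LieRingModule L A]
    [AddCommGroup M] [Module A M] [LieRingModule L M] : Prop where
  smul_lie (α : A) (x : L) (m : M) : ⁅α • x, m⁆ = α • ⁅x, m⁆
  lie_smul (x : L) (α : A) (m : M) : ⁅x, α • m⁆ = α • ⁅x, m⁆ + ⁅x, α⁆ • m

section Cohomology

set_option linter.unusedSectionVars false

variable {k A L M : Type*} [CommRing k] [CommRing A] [LieRing L] [Module A L] [LieRingModule L A]
  [AddCommGroup M] [Module A M] [LieRingModule L M]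

/-- The Chevalley–Eilenberg differential of a cochain `ω`, evaluated at `x₀, …, xₙ`:
`∑ᵢ (-1)ⁱ xᵢ ω(…, x̂ᵢ, …) + ∑_{i < j} (-1)^{i + j} ω([xᵢ, xⱼ], …, x̂ᵢ, …, x̂ⱼ, …)`.
In the double sum `x̂ⱼ` is removed first, and then `x̂ᵢ`. -/
def differentialAux : {n : ℕ} → (L [⋀^Fin n]→ₗ[A] M) → (Fin (n + 1) → L) → M
  | 0, ω, x => ⁅x 0, ω ![]⁆
  | n + 1, ω, x =>
    ∑ i : Fin (n + 2), (-1 : ℤ) ^ (i : ℕ) • ⁅x i, ω (i.removeNth x)⁆ +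
      ∑ j : Fin (n + 2), ∑ i : Fin (n + 1) with i.castSucc < j, (-1 : ℤ) ^ ((i : ℕ) + (j : ℕ)) •
        ω (Fin.cons ⁅x i.castSucc, x j⁆ (i.removeNth (j.removeNth x)))

theorem differentialAux_zero {n : ℕ} (x : Fin (n + 1) → L) :
    differentialAux (0 : L [⋀^Fin n]→ₗ[A] M) x = 0 := by
  cases n <;> simp [differentialAux]

theorem differentialAux_add {n : ℕ} (ω η : L [⋀^Fin n]→ₗ[A] M) (x : Fin (n + 1) → L) :
    differentialAux (ω + η) x = differentialAux ω x + differentialAux η x := by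
  cases n with
  | zero => simp [differentialAux]
  | succ n =>
    simp only [differentialAux, AlternatingMap.add_apply, lie_add, smul_add,
      Finset.sum_add_distrib]
    abel

/-- The sum `∑ⱼ ω(y₀, …, [x, yⱼ], …)`, written with `[x, yⱼ]` moved to the front. -/
theorem sum_update_eq {n : ℕ} (ω : L [⋀^Fin (n + 1)]→ₗ[A] M) (x : L) (y : Fin (n + 1) → L) :
    ∑ j, ω (Function.update y j ⁅x, y j⁆) =
      ∑ j : Fin (n + 1), (-1 : ℤ) ^ (j : ℕ) • ω (Fin.cons ⁅x, y j⁆ (j.removeNth y)) := by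
  refine Finset.sum_congr rfl fun j _ => ?_
  have h := AlternatingMap.map_insertNth ω j ⁅x, y j⁆ (j.removeNth y)
  rw [Fin.insertNth_removeNth] at h
  rw [h, Matrix.vecCons]

/-- Cartan's formula `ι_x ∘ d = L_x - d ∘ ι_x`. -/
theorem differentialAux_cons {n : ℕ} (ω : L [⋀^Fin (n + 1)]→ₗ[A] M) (x : L)
    (y : Fin (n + 1) → L) :
    differentialAux ω (Fin.cons x y) =
      ⁅x, ω y⁆ - ∑ j, ω (Function.update y j ⁅x, y j⁆) - differentialAux (ω.curryLeft x) y := by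
  rw [sum_update_eq]
  cases n with
  | zero =>
    have h0 (z : Fin 1 → L) : (Fin.removeNth 0 z) = ![] := Subsingleton.elim _ _
    have h1 (z : Fin 2 → L) : (Fin.removeNth 0 z) = ![z 1] := by
      ext j; fin_cases j; rfl
    have h2 (z : Fin 2 → L) : (Fin.removeNth 1 z) = ![z 0] := by
      ext j; fin_cases j; rfl
    have h3 : ![y 0] = y := by
      ext j; fin_cases j; rfl
    simp [differentialAux, Fin.sum_univ_succ, Finset.sum_filter, h0, h1, h2, h3]
    abel
  | succ n =>
    have h0 : Fin.removeNth 0 (Fin.cons x y : Fin (n + 3) → L) = y := by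
      ext j; simp [Fin.removeNth]
    have h1 (i : Fin (n + 2)) : Fin.removeNth i.succ (Fin.cons x y : Fin (n + 3) → L) =
        Fin.cons x (i.removeNth y) := by
      ext j; cases j using Fin.cases <;> simp [Fin.removeNth]
    have h2 (z : Fin (n + 1) → L) : Fin.removeNth 0 (Fin.cons x z : Fin (n + 2) → L) = z := by
      ext j; simp [Fin.removeNth]
    have h3 (i : Fin (n + 1)) (z : Fin (n + 1) → L) :
        Fin.removeNth i.succ (Fin.cons x z : Fin (n + 2) → L) = Fin.cons x (i.removeNth z) := by
      ext j; cases j using Fin.cases <;> simp [Fin.removeNth]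
    have h4 (u : L) (z : Fin n → L) :
        ω (Fin.cons u (Fin.cons x z)) = - ω (Fin.cons x (Fin.cons u z)) := by
      have h := ω.map_swap (Fin.cons x (Fin.cons u z)) (i := 0) (j := 1) (by simp)
      rw [← h]
      congr 1
      ext j
      refine Fin.cases ?_ (fun j => Fin.cases ?_ (fun j => ?_) j) j
      · simp
      · simp
      · rw [Function.comp_apply, Equiv.swap_apply_of_ne_of_ne]
        · simp
        · simp
        · simp [Fin.ext_iff]
    have h5 (z : Fin (n + 1) → L) : Matrix.vecCons x z = Fin.cons x z := rfl
    rw [differentialAux, differentialAux, Fin.sum_univ_succ, Fin.sum_univ_succ (n := n + 2)]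
    simp only [Finset.sum_filter, Fin.sum_univ_succ (n := n + 1) (f := fun i : Fin (n + 2) => ite _ _ _)]
    simp [h0, h1, h2, h3, h4, pow_succ, h5]
    have h6 (a b : ℕ) : (-1 : ℤ) ^ (a + 1 + (b + 1)) = (-1) ^ (a + b) := by ring
    rw [sub_eq_add_neg _ (_ + _), neg_add, ← Finset.sum_neg_distrib (f := fun j => ∑ i, _)]
    simp only [← Finset.sum_neg_distrib, neg_ite, neg_zero, h6]
    rw [Finset.sum_add_distrib, Finset.sum_neg_distrib (f := fun j => _ • ω _)]
    abel

section Differential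

variable [LieRinehartRing A L] [Representation A L M]

theorem sum_update_update {n : ℕ} (ω : L [⋀^Fin n]→ₗ[A] M) (x : L) (v : Fin n → L) (i : Fin n)
    (a : L) :
    ∑ j, ω (Function.update (Function.update v i a) j ⁅x, Function.update v i a j⁆) =
      ω (Function.update v i ⁅x, a⁆) + ∑ j ∈ Finset.univ.erase i,
        ω (Function.update (Function.update v j ⁅x, v j⁆) i a) := by
  rw [← Finset.add_sum_erase _ _ (Finset.mem_univ i)]
  congr 1
  · simp
  · refine Finset.sum_congr rfl fun j hj => ?_
    have hj : j ≠ i := Finset.ne_of_mem_erase hj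
    rw [Function.update_of_ne hj, Function.update_comm hj.symm]

/-- The Lie derivative `L_x ω` of a cochain. -/
def lieDerivative {n : ℕ} (x : L) (ω : L [⋀^Fin n]→ₗ[A] M) : L [⋀^Fin n]→ₗ[A] M where
  toFun v := ⁅x, ω v⁆ - ∑ j, ω (Function.update v j ⁅x, v j⁆)
  map_update_add' {inst} v i a b := by
    rw [Subsingleton.elim inst (instDecidableEqFin n)]
    simp only [sum_update_update, lie_add, AlternatingMap.map_update_add, Finset.sum_add_distrib]
    abel
  map_update_smul' {inst} v i α a := by
    rw [Subsingleton.elim inst (instDecidableEqFin n)]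
    simp only [sum_update_update, LieRinehartRing.leibniz_smul_right, Representation.lie_smul,
      AlternatingMap.map_update_add, AlternatingMap.map_update_smul, ← Finset.smul_sum]
    module
  map_eq_zero_of_eq' v i j hv hij := by
    have h : ∑ l, ω (Function.update v l ⁅x, v l⁆) =
        ω (Function.update v i ⁅x, v i⁆) + ω (Function.update v j ⁅x, v j⁆) := by
      refine Fintype.sum_eq_add i j hij fun l hl => ω.map_eq_zero_of_eq _ ?_ hij
      rw [Function.update_of_ne hl.1.symm, Function.update_of_ne hl.2.symm, hv]
    have h' : Function.update v j ⁅x, v j⁆ = Function.update v i ⁅x, v i⁆ ∘ Equiv.swap i j := by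
      ext l
      by_cases hi : l = i
      · subst hi; simp [hij, hij.symm, hv]
      by_cases hj : l = j
      · subst hj; simp [hv]
      simp [hi, hj, Equiv.swap_apply_of_ne_of_ne hi hj]
    rw [h, h', ω.map_swap _ hij, ω.map_eq_zero_of_eq v hv hij]
    simp

theorem lieDerivative_apply {n : ℕ} (x : L) (ω : L [⋀^Fin n]→ₗ[A] M) (v : Fin n → L) :
    lieDerivative x ω v = ⁅x, ω v⁆ - ∑ j, ω (Function.update v j ⁅x, v j⁆) := rfl

theorem lieDerivative_smul_left {n : ℕ} (α : A) (x : L) (ω : L [⋀^Fin (n + 1)]→ₗ[A] M)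
    (v : Fin (n + 1) → L) :
    lieDerivative (α • x) ω v = α • lieDerivative x ω v +
      ∑ j : Fin (n + 1), (-1 : ℤ) ^ (j : ℕ) • ⁅v j, α⁆ • ω.curryLeft x (j.removeNth v) := by
  have h (y : L) : ⁅α • x, y⁆ = α • ⁅x, y⁆ - ⁅y, α⁆ • x := by
    rw [← lie_skew, LieRinehartRing.leibniz_smul_right, ← lie_skew y x]; module
  have h' (j : Fin (n + 1)) : ω (Function.update v j x) =
      (-1 : ℤ) ^ (j : ℕ) • ω.curryLeft x (j.removeNth v) := by
    have h := AlternatingMap.map_insertNth ω j x (j.removeNth v)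
    rw [Fin.insertNth_removeNth] at h
    rw [h]; rfl
  simp only [lieDerivative_apply, h, Representation.smul_lie, AlternatingMap.map_update_sub,
    AlternatingMap.map_update_smul, Finset.sum_sub_distrib, ← Finset.smul_sum, h']
  rw [Finset.sum_congr rfl fun j _ => smul_comm ⁅v j, α⁆ ((-1 : ℤ) ^ (j : ℕ)) _]
  module

theorem differentialAux_smul {n : ℕ} (α : A) (ω : L [⋀^Fin n]→ₗ[A] M) (x : Fin (n + 1) → L) :
    differentialAux (α • ω) x = α • differentialAux ω x +
      ∑ i : Fin (n + 1), (-1 : ℤ) ^ (i : ℕ) • ⁅x i, α⁆ • ω (i.removeNth x) := by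
  cases n with
  | zero =>
    have h0 (z : Fin 1 → L) : (Fin.removeNth 0 z) = ![] := Subsingleton.elim _ _
    simp [differentialAux, Representation.lie_smul, h0]
  | succ n =>
    simp only [differentialAux, AlternatingMap.smul_apply, Representation.lie_smul, smul_add,
      Finset.sum_add_distrib, Finset.smul_sum]
    simp only [smul_comm α ((-1 : ℤ) ^ _)]
    abel

/-- Reassembling an alternating map from its contractions. -/
theorem exists_uncurry {n : ℕ} (F : L →ₗ[A] L [⋀^Fin (n + 1)]→ₗ[A] M)
    (hF : ∀ x z, F x (Fin.cons x z) = 0) :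
    ∃ D : L [⋀^Fin (n + 2)]→ₗ[A] M, ∀ x y, D (Fin.cons x y) = F x y := by
  have key (x : L) (y : Fin (n + 1) → L) (j : Fin (n + 1)) (h : y j = x) : F x y = 0 := by
    by_cases hj : j = 0
    · subst hj
      rw [← Fin.cons_self_tail y, h, hF]
    · have := (F x).map_swap y (i := 0) (j := j) (Ne.symm hj)
      rw [← neg_eq_iff_eq_neg] at this
      rw [← this, ← Fin.cons_self_tail (y ∘ Equiv.swap 0 j)]
      simp [h, hF]
  let f : MultilinearMap A (fun _ : Fin (n + 2) => L) M := LinearMap.uncurryLeft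
    ((AlternatingMap.toMultilinearMapLM (S := A)).comp F)
  have hf (v : Fin (n + 2) → L) : f v = F (v 0) (Fin.tail v) := rfl
  refine ⟨{ f with map_eq_zero_of_eq' := ?_ }, fun x y => ?_⟩
  · intro v i j hv hij
    change f v = 0
    rw [hf]
    induction i using Fin.cases with
    | zero =>
      induction j using Fin.cases with
      | zero => exact absurd rfl hij
      | succ j => exact key _ _ j hv.symm
    | succ i =>
      induction j using Fin.cases with
      | zero => exact key _ _ i hv
      | succ j => exact (F (v 0)).map_eq_zero_of_eq _ hv (fun h => hij (by rw [h]))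
  · change f _ = _
    rw [hf]
    simp

theorem exists_differential {n : ℕ} (ω : L [⋀^Fin n]→ₗ[A] M) :
    ∃ D : L [⋀^Fin (n + 1)]→ₗ[A] M, ∀ v, D v = differentialAux ω v := by
  induction n with
  | zero =>
    let f : L →ₗ[A] M :=
      { toFun := fun x => ⁅x, ω ![]⁆
        map_add' := fun x y => add_lie x y _
        map_smul' := fun α x => Representation.smul_lie α x _ }
    exact ⟨AlternatingMap.ofSubsingleton A L M (0 : Fin 1) f, fun v => rfl⟩
  | succ n ih =>
    choose D hD using ih
    let F : L →ₗ[A] L [⋀^Fin (n + 1)]→ₗ[A] M :=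
      { toFun := fun x => lieDerivative x ω - D (ω.curryLeft x)
        map_add' := fun x y => by
          ext v
          simp only [AlternatingMap.sub_apply, AlternatingMap.add_apply, hD, map_add,
            differentialAux_add, lieDerivative_apply, add_lie, AlternatingMap.map_update_add,
            Finset.sum_add_distrib]
          abel
        map_smul' := fun α x => by
          ext v
          simp only [AlternatingMap.sub_apply, AlternatingMap.smul_apply, hD, map_smul,
            differentialAux_smul, lieDerivative_smul_left, RingHom.id_apply]
          module }
    have hF (x : L) (y : Fin (n + 1) → L) : F x y = differentialAux ω (Fin.cons x y) := by
      rw [differentialAux_cons, ← hD]; rfl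
    obtain ⟨D', hD'⟩ := exists_uncurry F (fun x z => by
      rw [hF, differentialAux_cons, Fin.sum_univ_succ]
      cases n with
      | zero =>
        have hz : z = ![] := Subsingleton.elim _ _
        subst hz
        simp [differentialAux]
      | succ n =>
        have h0 : (ω.curryLeft x).curryLeft x = 0 := ω.curryLeft_same x
        have h1 (u : L) : Function.update (Fin.cons x z : Fin (n + 2) → L) 0 u = Fin.cons u z :=
          Fin.update_cons_zero (α := fun _ => L) x z u
        have h2 (j : Fin (n + 1)) (u : L) :
            Function.update (Fin.cons x z : Fin (n + 2) → L) j.succ u =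
              Fin.cons x (Function.update z j u) :=
          (Fin.cons_update (α := fun _ => L) x z j u).symm
        have h3 : ω (Fin.cons 0 z) = 0 := ω.map_coord_zero 0 rfl
        have h4 (w : Fin (n + 1) → L) : ω.curryLeft x w = ω (Fin.cons x w) := rfl
        rw [differentialAux_cons, h0, differentialAux_zero]
        simp only [h1, h2, h3, h4, Fin.cons_zero, Fin.cons_succ, lie_self]
        abel)
    refine ⟨D', fun v => ?_⟩
    rw [← Fin.cons_self_tail v, hD', hF]

theorem lie_algebraMap [Algebra k A] [LieAlgebra k L]
    [LieRinehartAlgebra k A L] (x : L) (c : k) : ⁅x, algebraMap k A c⁆ = 0 :=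
  (LieRinehartAlgebra.anchor k A L x).map_algebraMap c

variable (k A L M)

/-- The Chevalley–Eilenberg differential, from alternating `A`-multilinear maps `Lⁿ → M` to
alternating `A`-multilinear maps `Lⁿ⁺¹ → M`. It is `k`-linear, but not `A`-linear. -/
def differential [Algebra k A] [LieAlgebra k L] [LieRinehartAlgebra k A L] [Module k M]
    [IsScalarTower k A M] (n : ℕ) :
    (L [⋀^Fin n]→ₗ[A] M) →ₗ[k] (L [⋀^Fin (n + 1)]→ₗ[A] M) where
  toFun ω :=
    { toFun := differentialAux ω
      map_update_add' := fun v i x y => by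
        obtain ⟨D, hD⟩ := exists_differential ω
        simp only [← hD, AlternatingMap.map_update_add]
      map_update_smul' := fun v i α x => by
        obtain ⟨D, hD⟩ := exists_differential ω
        simp only [← hD, AlternatingMap.map_update_smul]
      map_eq_zero_of_eq' := fun v i j hv hij => by
        obtain ⟨D, hD⟩ := exists_differential ω
        change differentialAux ω v = 0
        rw [← hD, D.map_eq_zero_of_eq v hv hij] }
  map_add' ω η := AlternatingMap.ext fun v => differentialAux_add ω η v
  map_smul' c ω := AlternatingMap.ext fun v => by
    change differentialAux (c • ω) v = c • differentialAux ω v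
    have h : c • ω = algebraMap k A c • ω :=
      AlternatingMap.ext fun v => (algebraMap_smul A c (ω v)).symm
    rw [h, differentialAux_smul]
    simp only [lie_algebraMap, zero_smul, smul_zero, Finset.sum_const_zero, add_zero,
      algebraMap_smul]

variable [Algebra k A] [LieAlgebra k L] [LieRinehartAlgebra k A L] [Module k M]
  [IsScalarTower k A M]

/-- The cocycles of degree `n` of the Chevalley–Eilenberg complex. -/
def cocycles (n : ℕ) : Submodule k (L [⋀^Fin n]→ₗ[A] M) :=
  LinearMap.ker (differential k A L M n)

/-- The coboundaries of degree `n` of the Chevalley–Eilenberg complex. -/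
def coboundaries : (n : ℕ) → Submodule k (L [⋀^Fin n]→ₗ[A] M)
  | 0 => ⊥
  | n + 1 => LinearMap.range (differential k A L M n)

/-- The cohomology `Hⁿ(L; M)` of the Lie–Rinehart algebra `L` with coefficients in the
representation `M`: the cohomology of the Chevalley–Eilenberg complex. -/
abbrev Cohomology (n : ℕ) : Type _ :=
  cocycles k A L M n ⧸ (coboundaries k A L M n).submoduleOf (cocycles k A L M n)

section Complex

variable {A L M}

theorem lieDerivative_curryLeft {n : ℕ} (x y : L) (ω : L [⋀^Fin (n + 1)]→ₗ[A] M) :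
    (lieDerivative x ω).curryLeft y =
      lieDerivative x (ω.curryLeft y) - ω.curryLeft ⁅x, y⁆ := by
  ext v
  have h0 (w : Fin n → L) (u : L) : ω.curryLeft u w = ω (Fin.cons u w) := rfl
  have h1 (u : L) : Function.update (Fin.cons y v : Fin (n + 1) → L) 0 u = Fin.cons u v :=
    Fin.update_cons_zero (α := fun _ => L) y v u
  have h2 (j : Fin n) (u : L) : Function.update (Fin.cons y v : Fin (n + 1) → L) j.succ u =
      Fin.cons y (Function.update v j u) :=
    (Fin.cons_update (α := fun _ => L) y v j u).symm
  change lieDerivative x ω (Fin.cons y v) = _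
  rw [AlternatingMap.sub_apply, lieDerivative_apply, lieDerivative_apply, Fin.sum_univ_succ]
  simp only [h0, h1, h2, Fin.cons_zero, Fin.cons_succ]
  abel

theorem lieDerivative_add_right {n : ℕ} (x : L) (ω η : L [⋀^Fin n]→ₗ[A] M) :
    lieDerivative x (ω + η) = lieDerivative x ω + lieDerivative x η := by
  ext v
  simp only [lieDerivative_apply, AlternatingMap.add_apply, lie_add, Finset.sum_add_distrib]
  abel

theorem lieDerivative_sub_right {n : ℕ} (x : L) (ω η : L [⋀^Fin n]→ₗ[A] M) :
    lieDerivative x (ω - η) = lieDerivative x ω - lieDerivative x η := by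
  rw [eq_sub_iff_add_eq, ← lieDerivative_add_right, sub_add_cancel]

theorem ext_curryLeft {n : ℕ} {ω η : L [⋀^Fin (n + 1)]→ₗ[A] M}
    (h : ∀ x, ω.curryLeft x = η.curryLeft x) : ω = η := by
  ext v
  have := congrArg (fun θ => θ (Fin.tail v)) (h (v 0))
  rwa [AlternatingMap.curryLeft_apply_apply, AlternatingMap.curryLeft_apply_apply, Matrix.vecCons,
    Fin.cons_self_tail] at this

theorem lieDerivative_lie {n : ℕ} (x y : L) (ω : L [⋀^Fin n]→ₗ[A] M) :
    lieDerivative ⁅x, y⁆ ω =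
      lieDerivative x (lieDerivative y ω) - lieDerivative y (lieDerivative x ω) := by
  induction n with
  | zero =>
    ext v
    simp [lieDerivative_apply]
  | succ n ih =>
    refine ext_curryLeft fun z => ?_
    have h (θ τ : L [⋀^Fin (n + 1)]→ₗ[A] M) :
        (θ - τ).curryLeft z = θ.curryLeft z - τ.curryLeft z := rfl
    simp only [h, lieDerivative_curryLeft, ih, lieDerivative_sub_right, lie_lie, map_sub]
    abel

theorem differential_apply {n : ℕ} (ω : L [⋀^Fin n]→ₗ[A] M) (v : Fin (n + 1) → L) :
    differential k A L M n ω v = differentialAux ω v := rfl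

theorem differential_curryLeft_zero (ω : L [⋀^Fin 0]→ₗ[A] M) (x : L) :
    (differential k A L M 0 ω).curryLeft x = lieDerivative x ω := by
  ext v
  rw [Subsingleton.elim v ![], lieDerivative_apply]
  change ⁅x, ω ![]⁆ = _
  simp

theorem differential_curryLeft {n : ℕ} (ω : L [⋀^Fin (n + 1)]→ₗ[A] M) (x : L) :
    (differential k A L M (n + 1) ω).curryLeft x =
      lieDerivative x ω - differential k A L M n (ω.curryLeft x) := by
  ext v
  exact differentialAux_cons ω x v

theorem differential_lieDerivative {n : ℕ} (x : L) (ω : L [⋀^Fin n]→ₗ[A] M) :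
    differential k A L M n (lieDerivative x ω) = lieDerivative x (differential k A L M n ω) := by
  induction n with
  | zero =>
    refine ext_curryLeft fun y => ?_
    rw [lieDerivative_curryLeft, differential_curryLeft_zero, differential_curryLeft_zero,
      differential_curryLeft_zero, lieDerivative_lie]
    abel
  | succ n ih =>
    refine ext_curryLeft fun y => ?_
    rw [lieDerivative_curryLeft, differential_curryLeft, differential_curryLeft,
      differential_curryLeft, lieDerivative_curryLeft, map_sub, ih, lieDerivative_lie,
      lieDerivative_sub_right]
    abel

/-- The Chevalley–Eilenberg complex is a complex. -/
theorem differential_differential (n : ℕ) (ω : L [⋀^Fin n]→ₗ[A] M) :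
    differential k A L M (n + 1) (differential k A L M n ω) = 0 := by
  induction n with
  | zero =>
    refine ext_curryLeft fun y => ?_
    rw [differential_curryLeft, differential_curryLeft_zero, differential_lieDerivative, sub_self]
    rfl
  | succ n ih =>
    refine ext_curryLeft fun y => ?_
    rw [differential_curryLeft, differential_curryLeft, map_sub, ih,
      differential_lieDerivative, sub_zero, sub_self]
    rfl

end Complex

end Differential

end Cohomology

end LieRinehart

/-! ### Free Lie algebras: induction, derivations and elimination of a generator -/

namespace FreeLieAlgebra

variable {k S : Type*} [CommRing k]

attribute [local instance 100] LieRing.ofAssociativeRing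

/-! Freeness of the augmentation ideal. Modulo the left ideal generated by `S`, every element of `U
= 𝔘(L)` reduces to an element of `A`, and the augmentation separates `A` from that left ideal; so
`S` generates `K`. For independence, the module `A` is extended by the free module on `S`, a
generator `s` acting on `U^(S) × A` by `(f, α) ↦ (s f + α e_s, a(s)(α))`. This is a `U`-module
because the Lie algebra is free, and `∑ u_s s` sends `(0, 1)` to `(∑ u_s e_s, 0)`, which recovers
the coefficients (`extensionHom_linearCombination`).

Cohomology. An alternating `A`-multilinear map on `A ⊗ 𝔤` is the same as an alternating
`k`-multilinear map on `𝔤`, and the differentials agree since `[1 ⊗ ξ, 1 ⊗ η] = 1 ⊗ [ξ, η]`. It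
remains to see that a free Lie algebra over a field has no cohomology in degrees at least 2.

The engine is Lazard elimination: for a generator `t`, the free Lie algebra on `S` is `𝔥 ⊕ k t`,
where the ideal `𝔥` is free on the elements `ad(t)ʲ(s)`, `s ≠ t`. A cocycle that vanishes on `𝔥` is
governed by its contraction with `t`, and that contraction is removed either by induction on the
degree or, in degree 1, by solving a recursion in `j` (`exists_transgression_one`,
`exists_transgression_succ`). Elimination creates infinitely many generators, but heavier ones. With
weights on the generators and cochains considered only up to weight `d`, finitely many eliminations
leave nothing of weight at most `d` (`truncatedExact`).

Hence a cocycle has primitives on any finite set of tuples. If the coefficients are a dual space,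
the equation for a primitive is a linear system whose unknown is a linear form, and solvability of
the finite subsystems suffices (`exists_primitive_dual`). A general module embeds in its bidual, and
dimension shifting along this embedding concludes; it starts because 1-cocycles lift along
surjections of modules (`exists_cocycle_lift`). -/

theorem induction {P : FreeLieAlgebra k S → Prop} (x : FreeLieAlgebra k S)
    (of : ∀ s, P (of k s)) (zero : P 0) (add : ∀ x y, P x → P y → P (x + y))
    (smul : ∀ (c : k) x, P x → P (c • x)) (lie : ∀ x y, P x → P y → P ⁅x, y⁆) : P x := by
  let N : LieSubalgebra k (FreeLieAlgebra k S) :=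
    { carrier := {x | P x}
      add_mem' := fun hx hy => add _ _ hx hy
      zero_mem' := zero
      smul_mem' := fun c x hx => smul c x hx
      lie_mem' := fun hx hy => lie _ _ hx hy }
  -- The endomorphism that factors through `N` and fixes the generators is the identity, so `N` is
  -- everything.
  have h : N.incl.comp (FreeLieAlgebra.lift k fun s => (⟨FreeLieAlgebra.of k s, of s⟩ : N)) =
      LieHom.id := by
    ext s
    simp
  have hx := LieHom.congr_fun h x
  rw [LieHom.id_apply, LieHom.comp_apply] at hx
  rw [← hx]
  exact (FreeLieAlgebra.lift k (fun s => (⟨FreeLieAlgebra.of k s, of s⟩ : N)) x).2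

section Derivation

variable {M : Type*} [AddCommGroup M] [Module k M] [LieRingModule (FreeLieAlgebra k S) M]
  [LieModule k (FreeLieAlgebra k S) M]

/-- The affine endomorphism of `M` with linear part `x` and translation `m`, acting on `M × k`. -/
def affineEnd (x : FreeLieAlgebra k S) (m : M) : Module.End k (M × k) where
  toFun z := (⁅x, z.1⁆ + z.2 • m, 0)
  map_add' y z := by ext <;> simp [add_smul]; abel
  map_smul' c z := by ext <;> simp [mul_smul]

/-- Affine endomorphisms whose linear part is the action form a Lie algebra: the commutator of those
with translations `m` and `n` has translation `⁅x, n⁆ - ⁅y, m⁆`. This is the Leibniz rule, so the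
translation part of the lift is the desired derivation. -/
theorem exists_lift_affineEnd (f : S → M) (x : FreeLieAlgebra k S) :
    ∃ m, lift k (fun s => affineEnd (of k s) (f s)) x = affineEnd x m := by
  induction x using induction with
  | of s => exact ⟨f s, lift_of_apply _ _⟩
  | zero => exact ⟨0, by rw [map_zero]; ext <;> simp [affineEnd]⟩
  | add x y hx hy =>
    obtain ⟨m, hm⟩ := hx
    obtain ⟨n, hn⟩ := hy
    exact ⟨m + n, by rw [map_add, hm, hn]; ext <;> simp [affineEnd]⟩
  | smul c x hx =>
    obtain ⟨m, hm⟩ := hx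
    exact ⟨c • m, by rw [map_smul, hm]; ext <;> simp [affineEnd]⟩
  | lie x y hx hy =>
    obtain ⟨m, hm⟩ := hx
    obtain ⟨n, hn⟩ := hy
    exact ⟨⁅x, n⁆ - ⁅y, m⁆, by
      rw [LieHom.map_lie, hm, hn, Ring.lie_def]; ext <;> simp [affineEnd]⟩

/-- A derivation of a free Lie algebra with values in a module can be prescribed freely on the
generators. -/
theorem exists_lieDerivation (f : S → M) :
    ∃ D : LieDerivation k (FreeLieAlgebra k S) M, ∀ s, D (of k s) = f s := by
  let F : FreeLieAlgebra k S →ₗ⁅k⁆ Module.End k (M × k) :=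
    lift k fun s => affineEnd (of k s) (f s)
  have hF (x : FreeLieAlgebra k S) : F x = affineEnd x (F x (0, 1)).1 := by
    obtain ⟨m, hm⟩ := exists_lift_affineEnd f x
    have : (F x (0, 1)).1 = m := by
      rw [show F x = _ from hm]
      simp [affineEnd]
    rw [this]
    exact hm
  refine ⟨{ toFun := fun x => (F x (0, 1)).1
            map_add' := fun x y => by simp
            map_smul' := fun c x => by simp
            leibniz' := fun x y => ?_ }, fun s => ?_⟩
  · change (F ⁅x, y⁆ (0, 1)).1 = ⁅x, (F y (0, 1)).1⁆ - ⁅y, (F x (0, 1)).1⁆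
    rw [LieHom.map_lie, Ring.lie_def, LinearMap.sub_apply, Module.End.mul_apply,
      Module.End.mul_apply]
    generalize hm : (F x (0, 1)).1 = m
    generalize hn : (F y (0, 1)).1 = n
    rw [hF x, hF y, hm, hn]
    simp [affineEnd]
  · change (F (of k s) (0, 1)).1 = _
    rw [show F (of k s) = _ from lift_of_apply _ s]
    simp [affineEnd]

end Derivation

section Elimination

variable (k)

/-- The generators left after eliminating the generator `t`. -/
abbrev Eliminated (t : S) : Type _ := ℕ × {s : S // s ≠ t}

/-- The elimination morphism, which sends the generator `(j, s)` to `ad(t)ʲ(s)`. -/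
noncomputable def elim (t : S) : FreeLieAlgebra k (Eliminated t) →ₗ⁅k⁆ FreeLieAlgebra k S :=
  lift k fun x => (LieAlgebra.ad k _ (of k t) ^ x.1) (of k x.2.1)

theorem exists_shift (t : S) :
    ∃ D : LieDerivation k (FreeLieAlgebra k (Eliminated t)) (FreeLieAlgebra k (Eliminated t)),
      ∀ j s, D (of k (j, s)) = of k (j + 1, s) := by
  obtain ⟨D, hD⟩ := exists_lieDerivation (k := k)
    (fun x : Eliminated t => of k ((x.1 + 1, x.2) : Eliminated t))
  exact ⟨D, fun j s => hD (j, s)⟩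

/-- The derivation of the eliminated free Lie algebra induced by the bracket with `t`. -/
noncomputable def shift (t : S) :
    LieDerivation k (FreeLieAlgebra k (Eliminated t)) (FreeLieAlgebra k (Eliminated t)) :=
  (exists_shift k t).choose

theorem shift_of (t : S) (j : ℕ) (s : {s : S // s ≠ t}) :
    shift k t (of k (j, s)) = of k (j + 1, s) :=
  (exists_shift k t).choose_spec j s

theorem elim_of (t : S) (x : Eliminated t) :
    elim k t (of k x) = (LieAlgebra.ad k _ (of k t) ^ x.1) (of k x.2.1) :=
  lift_of_apply _ _

theorem elim_shift (t : S) (y : FreeLieAlgebra k (Eliminated t)) :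
    elim k t (shift k t y) = ⁅of k t, elim k t y⁆ := by
  induction y using induction with
  | of x =>
    obtain ⟨j, s⟩ := x
    rw [shift_of, elim_of, elim_of, pow_succ', Module.End.mul_apply, LieAlgebra.ad_apply]
  | zero => simp
  | add x y hx hy => simp [hx, hy]
  | smul c x hx => simp [hx]
  | lie x y hx hy =>
    rw [LieDerivation.apply_lie_eq_add, map_add, LieHom.map_lie, LieHom.map_lie, hx, hy,
      LieHom.map_lie, leibniz_lie (of k t)]
    abel

/-- Lazard elimination: `elim` is injective and its image is a complement of the line through `t`.
Here `p` is the projection onto the eliminated algebra and `c` is the coefficient of `t`. -/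
theorem exists_retraction (t : S) :
    ∃ (p : FreeLieAlgebra k S →ₗ[k] FreeLieAlgebra k (Eliminated t))
      (c : FreeLieAlgebra k S →ₗ[k] k),
      (∀ y, p (elim k t y) = y) ∧ (∀ y, c (elim k t y) = 0) ∧ p (of k t) = 0 ∧ c (of k t) = 1 ∧
      ∀ x, x = elim k t (p x) + c x • of k t := by
  classical
  let φ : FreeLieAlgebra k S →ₗ⁅k⁆
      LieDerivation k (FreeLieAlgebra k (Eliminated t)) (FreeLieAlgebra k (Eliminated t)) :=
    lift k fun s => if s = t then shift k t else 0
  -- In the semidirect sum, bracketing with `t` acts on the left factor by `shift`. Therefore `F ∘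
  -- elim` is the inclusion of the left factor, and the left component of `F` retracts `elim`.
  let F : FreeLieAlgebra k S →ₗ⁅k⁆ LieAlgebra.SemiDirectSum _ _ φ :=
    lift k fun s => if h : s = t then ⟨0, of k t⟩ else ⟨of k (0, ⟨s, h⟩), 0⟩
  have hφ : φ (of k t) = shift k t := by simp [φ]
  have hFt : F (of k t) = ⟨0, of k t⟩ := by simp [F]
  have hFs (s : {s : S // s ≠ t}) : F (of k s.1) = ⟨of k (0, s), 0⟩ := by simp [F, s.2]
  have hF (y : FreeLieAlgebra k (Eliminated t)) : F (elim k t y) = ⟨y, 0⟩ := by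
    have : F.comp (elim k t) = LieAlgebra.SemiDirectSum.inl φ := by
      ext ⟨j, s⟩ : 1
      rw [LieHom.comp_apply, elim_of, LieAlgebra.SemiDirectSum.inl_eq_mk]
      dsimp only
      induction j with
      | zero => rw [pow_zero, Module.End.one_apply, hFs]
      | succ j ih =>
        rw [pow_succ', Module.End.mul_apply, LieAlgebra.ad_apply, LieHom.map_lie, ih, hFt,
          LieAlgebra.SemiDirectSum.lie_eq_mk]
        simp [hφ, shift_of]
    exact LieHom.congr_fun this y
  have key (x : FreeLieAlgebra k S) : ∃ y, ∃ c : k, x = elim k t y + c • of k t := by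
    induction x using induction with
    | of s =>
      by_cases h : s = t
      · exact ⟨0, 1, by simp [h]⟩
      · exact ⟨of k (0, ⟨s, h⟩), 0, by simp [elim_of]⟩
    | zero => exact ⟨0, 0, by simp⟩
    | add x x' hx hx' =>
      obtain ⟨y, c, rfl⟩ := hx
      obtain ⟨y', c', rfl⟩ := hx'
      exact ⟨y + y', c + c', by rw [map_add]; module⟩
    | smul a x hx =>
      obtain ⟨y, c, rfl⟩ := hx
      exact ⟨a • y, a • c, by rw [map_smul]; module⟩
    | lie x x' hx hx' =>
      obtain ⟨y, c, rfl⟩ := hx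
      obtain ⟨y', c', rfl⟩ := hx'
      -- The image of `elim` is stable under `ad(t)`, which acts on it as `shift`, and `⁅t, t⁆ = 0`;
      -- so no multiple of `t` appears.
      refine ⟨⁅y, y'⁆ + c • shift k t y' - c' • shift k t y, 0, ?_⟩
      simp only [map_sub, map_add, map_smul, elim_shift, LieHom.map_lie, add_lie, lie_add, smul_lie,
        lie_smul, lie_self, ← lie_skew (elim k t y) (of k t)]
      module
  let χ : FreeLieAlgebra k S →ₗ⁅k⁆ k := lift k fun s => if s = t then 1 else 0
  have hχt : χ (of k t) = 1 := by simp [χ]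
  have hχ (y : FreeLieAlgebra k (Eliminated t)) : χ (elim k t y) = 0 := by
    induction y using induction with
    | of x =>
      obtain ⟨j, s⟩ := x
      rw [elim_of]
      cases j with
      | zero => simp [χ, s.2]
      | succ j =>
        rw [pow_succ', Module.End.mul_apply, LieAlgebra.ad_apply, LieHom.map_lie, Ring.lie_def,
          mul_comm, sub_self]
    | zero => simp
    | add x y hx hy => simp [hx, hy]
    | smul c x hx => simp [hx]
    | lie x y hx hy => rw [LieHom.map_lie, LieHom.map_lie, hx, hy, lie_self]
  refine ⟨(LieAlgebra.SemiDirectSum.projl φ).comp F.toLinearMap, χ.toLinearMap, fun y => ?_, hχ, ?_,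
    hχt, fun x => ?_⟩
  · change (F (elim k t y)).left = y
    rw [hF]
  · change (F (of k t)).left = 0
    rw [hFt]
  · obtain ⟨y, c, rfl⟩ := key x
    change _ = elim k t (F (elim k t y + c • of k t)).left + χ (elim k t y + c • of k t) • of k t
    rw [map_add, map_add, map_smul, map_smul, hF, hFt, hχ, hχt]
    simp

end Elimination

end FreeLieAlgebra

namespace LieRinehart

attribute [local instance 100] LieRing.ofAssociativeRing

/-! ### The enveloping algebra of a free Lie–Rinehart algebra and its augmentation ideal -/

section FreeAugmentation

variable {k A S : Type*} [CommRing k] [CommRing A] [Algebra k A] (a : S → Derivation k A A)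

namespace Transformation

variable {𝔤 : Type*} [LieRing 𝔤] [LieAlgebra k 𝔤] (ρ : 𝔤 →ₗ⁅k⁆ Derivation k A A)

theorem smul_tmul (α β : A) (ξ : 𝔤) : α • tmul ρ β ξ = tmul ρ (α * β) ξ :=
  TensorProduct.smul_tmul' α β ξ

theorem induction {P : Transformation ρ → Prop} (x : Transformation ρ) (zero : P 0)
    (tmul : ∀ α ξ, P (tmul ρ α ξ)) (add : ∀ x y, P x → P y → P (x + y)) : P x :=
  TensorProduct.induction_on (motive := P) x zero tmul add

theorem tmul_one_lie (ξ : 𝔤) (β : A) : ⁅tmul ρ 1 ξ, β⁆ = ρ ξ β := by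
  rw [tmul_lie, one_mul]

theorem tmul_one_lie_tmul_one (ξ η : 𝔤) : ⁅tmul ρ 1 ξ, tmul ρ 1 η⁆ = tmul ρ 1 ⁅ξ, η⁆ := by
  rw [tmul_lie_tmul, Derivation.map_one_eq_zero, Derivation.map_one_eq_zero, mul_zero, mul_one]
  simp only [tmul, TensorProduct.zero_tmul]
  exact (sub_zero _).trans (add_zero _)

variable {B : Type*} [Ring B] [Algebra k B] (i : A →ₐ[k] B) (f : 𝔤 →ₗ⁅k⁆ B)

/-- The `A`-linear extension of a morphism of Lie algebras `𝔤 → B` to the transformation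
Lie–Rinehart algebra. -/
noncomputable def extend : Transformation ρ →ₗ[k] B :=
  TensorProduct.lift ((LinearMap.mul k B).compl₁₂ i.toLinearMap f.toLinearMap)

theorem extend_tmul (α : A) (ξ : 𝔤) : extend ρ i f (tmul ρ α ξ) = i α * f ξ :=
  rfl

theorem extend_smul (α : A) (x : Transformation ρ) :
    extend ρ i f (α • x) = i α * extend ρ i f x := by
  induction x using Transformation.induction with
  | zero => simp
  | tmul β ξ => rw [smul_tmul, extend_tmul, extend_tmul, map_mul, mul_assoc]
  | add x y hx hy => rw [smul_add, map_add, map_add, hx, hy, mul_add]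

variable (h : ∀ ξ α, f ξ * i α = i α * f ξ + i (ρ ξ α))

include h in
theorem extend_anchor (x : Transformation ρ) (α : A) :
    i ⁅x, α⁆ = extend ρ i f x * i α - i α * extend ρ i f x := by
  induction x using Transformation.induction with
  | zero => simp
  | tmul β ξ =>
    have hc : i α * (i β * f ξ) = i β * (i α * f ξ) := by
      rw [← mul_assoc, ← map_mul, mul_comm α, map_mul, mul_assoc]
    rw [tmul_lie, extend_tmul, mul_assoc, h, map_mul, hc]
    noncomm_ring
  | add x y hx hy => rw [add_lie, map_add, map_add, hx, hy]; noncomm_ring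

-- The two correction terms of the bracket are what appears when `f ξ` is moved past `i β`, and `f
-- η` past `i α`, by means of `h`.
include h in
theorem extend_lie (x y : Transformation ρ) :
    extend ρ i f ⁅x, y⁆ = extend ρ i f x * extend ρ i f y - extend ρ i f y * extend ρ i f x := by
  induction x using Transformation.induction with
  | zero => simp
  | add x x' hx hx' => rw [add_lie, map_add, map_add, hx, hx']; noncomm_ring
  | tmul α ξ =>
    induction y using Transformation.induction with
    | zero => simp
    | add y y' hy hy' => rw [lie_add, map_add, map_add, hy, hy']; noncomm_ring
    | tmul β η =>
      have h1 : f ξ * (i β * f η) = i β * (f ξ * f η) + i (ρ ξ β) * f η := by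
        rw [← mul_assoc, h, add_mul, mul_assoc]
      have h2 : f η * (i α * f ξ) = i α * (f η * f ξ) + i (ρ η α) * f ξ := by
        rw [← mul_assoc, h, add_mul, mul_assoc]
      have h3 : i β * (i α * (f η * f ξ)) = i α * (i β * (f η * f ξ)) := by
        rw [← mul_assoc, ← map_mul, mul_comm β, map_mul, mul_assoc]
      rw [tmul_lie_tmul]
      simp only [map_add, map_sub, extend_tmul, LieHom.map_lie, Ring.lie_def, map_mul, mul_assoc,
        h1, h2, mul_add, mul_sub, h3]
      abel

/-- The universal property of the enveloping algebra of a transformation Lie–Rinehart algebra. -/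
noncomputable def liftEnveloping : Enveloping k A (Transformation ρ) →ₐ[k] B :=
  Enveloping.lift i (extend ρ i f) (map_add _) (extend_smul ρ i f) (extend_lie ρ i f h)
    (extend_anchor ρ i f h)

theorem liftEnveloping_ofBase (α : A) :
    liftEnveloping ρ i f h (Enveloping.ofBase k A _ α) = i α :=
  Enveloping.lift_ofBase _ _ _ _ _ _ α

theorem liftEnveloping_of_tmul (α : A) (ξ : 𝔤) :
    liftEnveloping ρ i f h (Enveloping.of k A _ (tmul ρ α ξ)) = i α * f ξ :=
  Enveloping.lift_of _ _ _ _ _ _ _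

end Transformation

/-- Elements are sums of words, and a word is built from `1` by adding letters on the left. The
proof strengthens the claim to stability of `P` under left multiplication by `u`, which passes to
products. -/
theorem Enveloping.induction_mul {L : Type*} [LieRing L] [Module A L] [LieRingModule L A]
    {P : Enveloping k A L → Prop} (u : Enveloping k A L) (one : P 1)
    (add : ∀ u v, P u → P v → P (u + v))
    (ofBase_mul : ∀ α u, P u → P (ofBase k A L α * u))
    (of_mul : ∀ x u, P u → P (of k A L x * u)) : P u := by
  suffices h : ∀ v, P v → P (u * v) by simpa using h 1 one
  obtain ⟨u, rfl⟩ := RingQuot.mkAlgHom_surjective k (EnvelopingRel k A L) u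
  induction u using FreeAlgebra.induction with
  | grade0 c =>
    intro v hv
    rw [AlgHom.commutes, ← AlgHom.commutes (ofBase k A L)]
    exact ofBase_mul _ _ hv
  | grade1 s =>
    intro v hv
    cases s with
    | inl α => exact ofBase_mul _ _ hv
    | inr x => exact of_mul _ _ hv
  | mul u u' h h' =>
    intro v hv
    rw [map_mul, mul_assoc]
    exact h _ (h' _ hv)
  | add u u' h h' =>
    intro v hv
    rw [map_add, add_mul]
    exact add _ _ (h _ hv) (h' _ hv)

/-- The element of the universal enveloping algebra of a free Lie–Rinehart algebra given by an
element of the free Lie algebra. -/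
noncomputable def envelopingOf (ξ : FreeLieAlgebra k S) :
    Enveloping k A (FreeLieRinehart a) :=
  Enveloping.of k A _ (Transformation.tmul _ 1 ξ)

theorem envelopingOf_mul_ofBase (ξ : FreeLieAlgebra k S) (α : A) :
    envelopingOf a ξ * Enveloping.ofBase k A _ α =
      Enveloping.ofBase k A _ α * envelopingOf a ξ +
        Enveloping.ofBase k A _ (FreeLieAlgebra.lift k a ξ α) := by
  rw [← Transformation.tmul_one_lie, Enveloping.ofBase_lie, envelopingOf]
  abel

theorem of_tmul (α : A) (ξ : FreeLieAlgebra k S) :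
    Enveloping.of k A (FreeLieRinehart a) (Transformation.tmul _ α ξ) =
      Enveloping.ofBase k A _ α * envelopingOf a ξ := by
  rw [envelopingOf, ← Enveloping.of_smul, Transformation.smul_tmul, mul_one]

theorem envelopingOf_add (ξ η : FreeLieAlgebra k S) :
    envelopingOf a (ξ + η) = envelopingOf a ξ + envelopingOf a η := by
  rw [envelopingOf, envelopingOf, envelopingOf, ← Enveloping.of_add]
  exact congrArg _ (TensorProduct.tmul_add _ _ _)

theorem envelopingOf_zero : envelopingOf a 0 = 0 := by
  simpa using envelopingOf_add a 0 0

theorem envelopingOf_smul (c : k) (ξ : FreeLieAlgebra k S) :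
    envelopingOf a (c • ξ) = c • envelopingOf a ξ := by
  rw [Algebra.smul_def, ← AlgHom.commutes (Enveloping.ofBase k A (FreeLieRinehart a)), ← of_tmul,
    envelopingOf]
  congr 1
  change (1 : A) ⊗ₜ[k] (c • ξ) = (algebraMap k A c) ⊗ₜ[k] ξ
  rw [← TensorProduct.smul_tmul, Algebra.smul_def, mul_one]

theorem envelopingOf_lie (ξ η : FreeLieAlgebra k S) :
    envelopingOf a ⁅ξ, η⁆ =
      envelopingOf a ξ * envelopingOf a η - envelopingOf a η * envelopingOf a ξ := by
  rw [envelopingOf, ← Transformation.tmul_one_lie_tmul_one, Enveloping.of_lie]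
  rfl

theorem augmentation_mul_envelopingOf (u : Enveloping k A (FreeLieRinehart a))
    (ξ : FreeLieAlgebra k S) : augmentation k A _ (u * envelopingOf a ξ) = 0 := by
  change anchorHom k A _ (u * envelopingOf a ξ) 1 = 0
  rw [map_mul, Module.End.mul_apply]
  have h : anchorHom k A (FreeLieRinehart a) (envelopingOf a ξ) 1 = 0 := by
    rw [envelopingOf, anchorHom, Enveloping.lift_of]
    exact (Transformation.tmul_one_lie (FreeLieAlgebra.lift k a) ξ 1).trans
      (Derivation.map_one_eq_zero _)
  rw [h, map_zero]

theorem augmentation_ofBase (α : A) :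
    augmentation k A _ (Enveloping.ofBase k A (FreeLieRinehart a) α) = α := by
  change anchorHom k A _ (Enveloping.ofBase k A (FreeLieRinehart a) α) 1 = α
  rw [anchorHom, Enveloping.lift_ofBase]
  simp

/-- The generator of the augmentation ideal given by an element of the free Lie algebra. -/
noncomputable def augmentationGenerator (s : S) :
    augmentationIdeal k A (FreeLieRinehart a) :=
  ⟨envelopingOf a (FreeLieAlgebra.of k s), by
    have h := augmentation_mul_envelopingOf a 1 (FreeLieAlgebra.of k s)
    rwa [one_mul] at h⟩

/-- The generation half: the left ideal generated by `S`, together with the image of `A`, is stable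
under left multiplication by letters. It contains the whole free Lie algebra because brackets become
commutators. -/
theorem exists_eq_linearCombination_add (u : Enveloping k A (FreeLieRinehart a)) :
    ∃ (f : S →₀ Enveloping k A (FreeLieRinehart a)) (α : A),
      u = Finsupp.linearCombination _ (fun s => envelopingOf a (FreeLieAlgebra.of k s)) f +
        Enveloping.ofBase k A _ α := by
  let Φ := Finsupp.linearCombination (Enveloping k A (FreeLieRinehart a))
    (fun s => envelopingOf a (FreeLieAlgebra.of k s))
  have hgen (ξ : FreeLieAlgebra k S) : envelopingOf a ξ ∈ LinearMap.range Φ := by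
    induction ξ using FreeLieAlgebra.induction with
    | of s => exact ⟨Finsupp.single s 1, by simp [Φ]⟩
    | zero => rw [envelopingOf_zero]; exact zero_mem _
    | add ξ η h h' => rw [envelopingOf_add]; exact add_mem h h'
    | smul c ξ h =>
      rw [envelopingOf_smul, Algebra.smul_def]
      exact Submodule.smul_mem _ _ h
    | lie ξ η h h' =>
      rw [envelopingOf_lie]
      exact sub_mem (Submodule.smul_mem _ _ h') (Submodule.smul_mem _ _ h)
  suffices h : ∃ v ∈ LinearMap.range Φ, ∃ α, u = v + Enveloping.ofBase k A _ α by
    obtain ⟨_, ⟨f, rfl⟩, α, h⟩ := h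
    exact ⟨f, α, h⟩
  induction u using Enveloping.induction_mul with
  | one => exact ⟨0, zero_mem _, 1, by simp⟩
  | add u u' h h' =>
    obtain ⟨v, hv, α, rfl⟩ := h
    obtain ⟨v', hv', α', rfl⟩ := h'
    exact ⟨v + v', add_mem hv hv', α + α', by rw [map_add]; abel⟩
  | ofBase_mul β u h =>
    obtain ⟨v, hv, α, rfl⟩ := h
    exact ⟨_, Submodule.smul_mem _ (Enveloping.ofBase k A _ β) hv, β * α, by
      rw [map_mul, mul_add, smul_eq_mul]⟩
  | of_mul x u h =>
    obtain ⟨v, hv, α, rfl⟩ := h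
    induction x using Transformation.induction with
    | zero =>
      have : Enveloping.of k A (FreeLieRinehart a) 0 = 0 := by
        simpa using Enveloping.of_add k A (FreeLieRinehart a) 0 0
      exact ⟨0, zero_mem _, 0, by rw [this]; simp⟩
    | add x y hx hy =>
      obtain ⟨w, hw, β, h⟩ := hx
      obtain ⟨w', hw', β', h'⟩ := hy
      exact ⟨w + w', add_mem hw hw', β + β', by
        rw [Enveloping.of_add, add_mul, h, h', map_add]; abel⟩
    | tmul β ξ =>
      -- The product `βξ(v + α)` equals `(βξ) v + (βα) ξ + β a(ξ)(α)`; only the last term lies in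
      -- `A`.
      refine ⟨(Enveloping.ofBase k A _ β * envelopingOf a ξ) • v +
        (Enveloping.ofBase k A _ β * Enveloping.ofBase k A _ α) • envelopingOf a ξ,
        add_mem (Submodule.smul_mem _ _ hv) (Submodule.smul_mem _ _ (hgen ξ)),
        β * FreeLieAlgebra.lift k a ξ α, ?_⟩
      rw [of_tmul, mul_add, mul_assoc _ _ (Enveloping.ofBase k A _ α), envelopingOf_mul_ofBase,
        smul_eq_mul, smul_eq_mul, map_mul]
      noncomm_ring

/-! ### The extension of `A` by a free module, which detects coefficients -/

section Extension

variable {U : Type*} [Ring U] [Algebra k U] (i : A →ₐ[k] U) (e : S → U)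

/-- The extension of the module `A` by the free module on `S` in which a generator `s` maps `1 ∈ A`
to the basis vector indexed by `s`. -/
noncomputable def extensionGenerator (s : S) : Module.End k ((S →₀ U) × A) where
  toFun z := (e s • z.1 + Finsupp.single s (i z.2), a s z.2)
  map_add' y z := by
    ext1
    · simp only [Prod.fst_add, Prod.snd_add, smul_add, map_add, Finsupp.single_add]; abel
    · simp
  map_smul' c z := by
    ext1
    · simp only [Prod.smul_fst, Prod.smul_snd, RingHom.id_apply, map_smul, smul_add,
        Finsupp.smul_single]
      rw [smul_comm]
    · simp

/-- The action of `A` on the extension. -/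
noncomputable def extensionBase : A →ₐ[k] Module.End k ((S →₀ U) × A) :=
  AlgHom.ofLinearMap
    { toFun := fun α =>
        { toFun := fun z => (i α • z.1, α * z.2)
          map_add' := fun y z => by simp [mul_add]
          map_smul' := fun c z => Prod.ext (smul_comm _ _ _) (mul_smul_comm _ _ _) }
      map_add' := fun α β => LinearMap.ext fun z => by simp [add_smul, add_mul]
      map_smul' := fun c α => LinearMap.ext fun z => by simp [smul_assoc] }
    (LinearMap.ext fun z => by simp)
    (fun α β => LinearMap.ext fun z => by simp [mul_smul, mul_assoc])

theorem extensionBase_apply (α : A) (z : (S →₀ U) × A) :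
    extensionBase i α z = (i α • z.1, α * z.2) := rfl

/-- On a generator, the component in `S →₀ U` is `he` and the component in `A` is the Leibniz rule.
The relation says that commuting with the operators of `A` realizes the derivation attached to `ξ`,
a condition stable under commutators in `ξ`. -/
theorem extension_commutation (he : ∀ s α, e s * i α = i α * e s + i (a s α))
    (ξ : FreeLieAlgebra k S) (α : A) :
    FreeLieAlgebra.lift k (extensionGenerator a i e) ξ * extensionBase i α =
      extensionBase i α * FreeLieAlgebra.lift k (extensionGenerator a i e) ξ +
        extensionBase i (FreeLieAlgebra.lift k a ξ α) := by
  induction ξ using FreeLieAlgebra.induction generalizing α with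
  | of s =>
    rw [FreeLieAlgebra.lift_of_apply, FreeLieAlgebra.lift_of_apply]
    refine LinearMap.ext fun z => ?_
    simp only [Module.End.mul_apply, LinearMap.add_apply, extensionBase_apply, extensionGenerator,
      LinearMap.coe_mk, AddHom.coe_mk, ← mul_smul, he, Prod.mk_add_mk, smul_add,
      Derivation.leibniz, smul_eq_mul]
    ext1
    · simp only [add_smul, mul_smul, map_mul, Finsupp.smul_single, smul_eq_mul]
      abel
    · simp only
      ring
  | zero => simp
  | add ξ η h h' =>
    simp only [map_add, add_mul, h, h', mul_add, Derivation.add_apply]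
    abel
  | smul c ξ h => simp [h]
  | lie ξ η h h' =>
    rw [LieHom.map_lie, LieHom.map_lie, Ring.lie_def, sub_mul, mul_assoc, mul_assoc, h, h', mul_add,
      mul_add, ← mul_assoc, ← mul_assoc, h, h', add_mul, add_mul, h, h',
      Derivation.commutator_apply, map_sub, mul_sub, mul_assoc, mul_assoc]
    abel

variable (φ : Enveloping k A (FreeLieRinehart a) →ₐ[k] U)

/-- The action of the free Lie algebra on the extension. -/
noncomputable def extensionLie : FreeLieAlgebra k S →ₗ⁅k⁆ Module.End k ((S →₀ U) × A) :=
  FreeLieAlgebra.lift k (extensionGenerator a (φ.comp (Enveloping.ofBase k A (FreeLieRinehart a)))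
    (fun s => φ (envelopingOf a (FreeLieAlgebra.of k s))))

theorem extensionLie_commutation (ξ : FreeLieAlgebra k S) (α : A) :
    extensionLie a φ ξ * extensionBase (φ.comp (Enveloping.ofBase k A (FreeLieRinehart a))) α =
      extensionBase (φ.comp (Enveloping.ofBase k A (FreeLieRinehart a))) α * extensionLie a φ ξ +
        extensionBase (φ.comp (Enveloping.ofBase k A (FreeLieRinehart a)))
          (FreeLieAlgebra.lift k a ξ α) :=
  extension_commutation a _ _ (fun s α => by
    have h := envelopingOf_mul_ofBase a (FreeLieAlgebra.of k s) α
    rw [FreeLieAlgebra.lift_of_apply] at h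
    simp only [AlgHom.comp_apply, ← map_mul, ← map_add, h]) ξ α

/-- The `U(L)`-module structure on the extension. -/
noncomputable def extensionHom :
    Enveloping k A (FreeLieRinehart a) →ₐ[k] Module.End k ((S →₀ U) × A) :=
  Transformation.liftEnveloping _
    (extensionBase (φ.comp (Enveloping.ofBase k A (FreeLieRinehart a)))) (extensionLie a φ)
    (extensionLie_commutation a φ)

theorem extensionHom_envelopingOf (ξ : FreeLieAlgebra k S) :
    extensionHom a φ (envelopingOf a ξ) = extensionLie a φ ξ := by
  rw [envelopingOf, extensionHom, Transformation.liftEnveloping_of_tmul, map_one, one_mul]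

theorem extensionHom_ofBase_apply (α : A) (z : (S →₀ U) × A) :
    extensionHom a φ (Enveloping.ofBase k A _ α) z =
      (φ (Enveloping.ofBase k A _ α) • z.1, α * z.2) := by
  exact LinearMap.congr_fun (Transformation.liftEnveloping_ofBase (FreeLieAlgebra.lift k a) _ _
    (extensionLie_commutation a φ) α) z

theorem extensionLie_apply (ξ : FreeLieAlgebra k S) (f : S →₀ U) :
    extensionLie a φ ξ (f, 0) = (φ (envelopingOf a ξ) • f, 0) := by
  induction ξ using FreeLieAlgebra.induction generalizing f with
  | of s =>
    rw [extensionLie, FreeLieAlgebra.lift_of_apply]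
    simp [extensionGenerator]
  | zero => rw [map_zero, LinearMap.zero_apply, envelopingOf_zero, map_zero, zero_smul,
      Prod.mk_zero_zero]
  | add ξ η h h' => simp [h, h', envelopingOf_add, add_smul]
  | smul c ξ h => simp [h, envelopingOf_smul]
  | lie ξ η h h' =>
    rw [LieHom.map_lie, Ring.lie_def, LinearMap.sub_apply, Module.End.mul_apply,
      Module.End.mul_apply, h, h', h, h', envelopingOf_lie, map_sub, map_mul, map_mul, sub_smul,
      mul_smul, mul_smul, Prod.mk_sub_mk, sub_zero]

theorem extensionHom_apply (u : Enveloping k A (FreeLieRinehart a)) (f : S →₀ U) :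
    extensionHom a φ u (f, 0) = (φ u • f, 0) := by
  induction u using Enveloping.induction_mul with
  | one => simp
  | add u v h h' => simp [h, h', add_smul]
  | ofBase_mul α u h =>
    rw [map_mul, Module.End.mul_apply, h, extensionHom_ofBase_apply, map_mul, mul_smul, mul_zero]
  | of_mul x u h =>
    induction x using Transformation.induction with
    | zero =>
      have : Enveloping.of k A (FreeLieRinehart a) 0 = 0 := by
        simpa using Enveloping.of_add k A (FreeLieRinehart a) 0 0
      rw [this, zero_mul, map_zero, LinearMap.zero_apply, map_zero, zero_smul, Prod.mk_zero_zero]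
    | add x y hx hy =>
      rw [Enveloping.of_add, add_mul, map_add, LinearMap.add_apply, hx, hy, map_add, add_smul,
        Prod.mk_add_mk, add_zero]
    | tmul α ξ =>
      rw [of_tmul, map_mul, Module.End.mul_apply, h, map_mul, Module.End.mul_apply,
        extensionHom_envelopingOf, extensionLie_apply, extensionHom_ofBase_apply, map_mul, map_mul,
        mul_smul, mul_smul, mul_zero]

/-- The independence half. As `a(s)(1) = 0`, the generator `s` sends `(0, 1)` to `(e_s, 0)`, and on
the free summand `U(L)` acts by left multiplication through `φ`. Evaluation at `(0, 1)` thus reads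
off the coefficients; `φ = id` is the case applied below. -/
theorem extensionHom_linearCombination (f : S →₀ Enveloping k A (FreeLieRinehart a)) :
    extensionHom a φ (Finsupp.linearCombination _
      (fun s => envelopingOf a (FreeLieAlgebra.of k s)) f) (0, 1) =
        (f.mapRange φ (map_zero φ), 0) := by
  induction f using Finsupp.induction_linear with
  | zero => rw [map_zero, map_zero, Finsupp.mapRange_zero]; rfl
  | add f g hf hg =>
    rw [map_add, map_add, LinearMap.add_apply, hf, hg, Prod.mk_add_mk, add_zero,
      Finsupp.mapRange_add (map_add φ)]
  | single s u =>
    have h : extensionLie a φ (FreeLieAlgebra.of k s) (0, 1) = (Finsupp.single s 1, 0) := by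
      rw [extensionLie, FreeLieAlgebra.lift_of_apply]
      simp [extensionGenerator]
    rw [Finsupp.linearCombination_single, smul_eq_mul, map_mul, Module.End.mul_apply,
      extensionHom_envelopingOf, h, extensionHom_apply, Finsupp.smul_single, smul_eq_mul, mul_one,
      Finsupp.mapRange_single]

end Extension

/-- The augmentation ideal of the enveloping algebra of a free Lie–Rinehart algebra is free on the
generators. -/
theorem free_augmentationIdeal :
    Module.Free (Enveloping k A (FreeLieRinehart a))
      (augmentationIdeal k A (FreeLieRinehart a)) := by
  let Φ := Finsupp.linearCombination (Enveloping k A (FreeLieRinehart a))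
    (augmentationGenerator a)
  have hΦ (f : S →₀ Enveloping k A (FreeLieRinehart a)) : (Φ f : Enveloping k A _) =
      Finsupp.linearCombination _ (fun s => envelopingOf a (FreeLieAlgebra.of k s)) f := by
    change (augmentationIdeal k A (FreeLieRinehart a)).subtype (Φ f) = _
    rw [Finsupp.apply_linearCombination]
    rfl
  refine Module.Free.of_equiv (LinearEquiv.ofBijective Φ ⟨fun f g h => ?_, fun u => ?_⟩)
  · have h' : (Φ f : Enveloping k A (FreeLieRinehart a)) = Φ g := congrArg Subtype.val h
    rw [hΦ, hΦ] at h'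
    have hf := extensionHom_linearCombination a (AlgHom.id k _) f
    rw [h', extensionHom_linearCombination] at hf
    refine Finsupp.ext fun s => ?_
    exact (DFunLike.congr_fun (congrArg Prod.fst hf) s).symm
  · obtain ⟨f, α, h⟩ := exists_eq_linearCombination_add a (u : Enveloping k A _)
    refine ⟨f, Subtype.ext ?_⟩
    -- The augmentation kills both `u` and the combination of generators and is the identity on `A`,
    -- so the remainder `α` is zero.
    have hu : augmentation k A (FreeLieRinehart a) u = 0 := u.2
    have hf : augmentation k A (FreeLieRinehart a) (Φ f) = 0 := (Φ f).2
    rw [h, ← hΦ, map_add, hf, augmentation_ofBase, zero_add] at hu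
    rw [h, hΦ, hu, map_zero, add_zero]

end FreeAugmentation

end LieRinehart

namespace LieRinehart

/-! ### Exterior product with a linear form -/

section Wedge

variable {k 𝔤 M : Type*} [CommRing k] [AddCommGroup 𝔤] [Module k 𝔤] [AddCommGroup M] [Module k M]

/-- The exterior product `c ∧ ω` of a linear form with an alternating map. -/
noncomputable def wedge (c : 𝔤 →ₗ[k] k) {n : ℕ} (ω : 𝔤 [⋀^Fin n]→ₗ[k] M) :
    𝔤 [⋀^Fin (n + 1)]→ₗ[k] M :=
  AlternatingMap.alternatizeUncurryFin (c.smulRight ω)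

theorem wedge_apply (c : 𝔤 →ₗ[k] k) {n : ℕ} (ω : 𝔤 [⋀^Fin n]→ₗ[k] M) (v : Fin (n + 1) → 𝔤) :
    wedge c ω v = ∑ i : Fin (n + 1), (-1 : ℤ) ^ (i : ℕ) • c (v i) • ω (i.removeNth v) := by
  rw [wedge, AlternatingMap.alternatizeUncurryFin_apply]
  rfl

theorem compLinearMap_wedge {𝔥 : Type*} [AddCommGroup 𝔥] [Module k 𝔥] (i : 𝔥 →ₗ[k] 𝔤)
    (c : 𝔤 →ₗ[k] k) (hc : ∀ y, c (i y) = 0) {n : ℕ} (ω : 𝔤 [⋀^Fin n]→ₗ[k] M) :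
    (wedge c ω).compLinearMap i = 0 := by
  ext v
  simp [wedge_apply, hc]

/-- Among the terms of `c ∧ ω` only the one that feeds `t` to `c` survives. Thus wedging with `c`
inverts contraction with `t`, up to restriction along `i`. -/
theorem compLinearMap_curryLeft_wedge {𝔥 : Type*} [AddCommGroup 𝔥] [Module k 𝔥] (i : 𝔥 →ₗ[k] 𝔤)
    (c : 𝔤 →ₗ[k] k) (hc : ∀ y, c (i y) = 0) {t : 𝔤} (ht : c t = 1) {n : ℕ}
    (ω : 𝔤 [⋀^Fin n]→ₗ[k] M) :
    ((wedge c ω).curryLeft t).compLinearMap i = ω.compLinearMap i := by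
  ext v
  change wedge c ω (Fin.cons t (i ∘ v)) = ω (i ∘ v)
  rw [wedge_apply, Fin.sum_univ_succ]
  have h : Fin.removeNth 0 (Fin.cons t (i ∘ v) : Fin (n + 1) → 𝔤) = i ∘ v := by
    ext j; simp [Fin.removeNth]
  simp [hc, ht, h]

theorem curryLeft_curryLeft {n : ℕ} (ω : 𝔤 [⋀^Fin (n + 2)]→ₗ[k] M) (x y : 𝔤) :
    (ω.curryLeft x).curryLeft y = -(ω.curryLeft y).curryLeft x := by
  have h := ω.curryLeft_same (x + y)
  have hadd (η θ : 𝔤 [⋀^Fin (n + 1)]→ₗ[k] M) (z : 𝔤) :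
      (η + θ).curryLeft z = η.curryLeft z + θ.curryLeft z := rfl
  rw [map_add, map_add, hadd, hadd, ω.curryLeft_same, ω.curryLeft_same, zero_add, add_zero] at h
  exact eq_neg_of_add_eq_zero_right h

end Wedge

/-! ### Lie algebras as Lie–Rinehart algebras with zero anchor; functoriality of cochains -/

section LieAlgebraCohomology

variable {k 𝔤 M : Type*} [CommRing k] [LieRing 𝔤] [LieAlgebra k 𝔤] [AddCommGroup M] [Module k M]
  [LieRingModule 𝔤 M] [LieModule k 𝔤 M]

variable (k 𝔤) in
/-- The trivial action of a Lie algebra on its base ring, which makes a Lie algebra a Lie–Rinehart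
algebra with zero anchor. -/
@[reducible]
def trivialLieRingModule : LieRingModule 𝔤 k where
  bracket _ _ := 0
  add_lie _ _ _ := (add_zero 0).symm
  lie_add _ _ _ := (add_zero 0).symm
  leibniz_lie _ _ _ := (add_zero 0).symm

attribute [local instance] trivialLieRingModule

omit [LieAlgebra k 𝔤] in
theorem trivial_lie (x : 𝔤) (c : k) : ⁅x, c⁆ = 0 := rfl

theorem lieRinehartRing_trivial : LieRinehartRing k 𝔤 where
  lie_smul_eq_mul' _ _ _ := (mul_zero _).symm
  leibniz_mul_right' x a b := by simp [trivial_lie]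
  leibniz_smul_right' x y a := by simp [trivial_lie]

attribute [local instance] lieRinehartRing_trivial

theorem lieRinehartAlgebra_trivial : LieRinehartAlgebra k k 𝔤 where
  smul_lie c x a := by simp [trivial_lie]
  lie_smul c x a := by simp [trivial_lie]

theorem representation_trivial : Representation k 𝔤 M where
  smul_lie c x m := LieModule.smul_lie c x m
  lie_smul x c m := by simp [trivial_lie]

attribute [local instance] lieRinehartAlgebra_trivial representation_trivial

section Functoriality

variable {𝔥 N : Type*} [LieRing 𝔥] [LieAlgebra k 𝔥] [LieRingModule 𝔥 M] [LieModule k 𝔥 M]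
  [AddCommGroup N] [Module k N] [LieRingModule 𝔤 N] [LieModule k 𝔤 N]

theorem differential_compLinearMap (i : 𝔥 →ₗ⁅k⁆ 𝔤) (hi : ∀ (y : 𝔥) (m : M), ⁅y, m⁆ = ⁅i y, m⁆)
    {n : ℕ} (ω : 𝔤 [⋀^Fin n]→ₗ[k] M) :
    differential k k 𝔥 M n (ω.compLinearMap i.toLinearMap) =
      (differential k k 𝔤 M n ω).compLinearMap i.toLinearMap := by
  ext v
  rw [AlternatingMap.compLinearMap_apply, differential_apply, differential_apply]
  cases n with
  | zero =>
    rw [differentialAux, differentialAux, hi, AlternatingMap.compLinearMap_apply]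
    congr 2
    exact Subsingleton.elim _ _
  | succ n =>
    rw [differentialAux, differentialAux]
    congr 1
    · refine Finset.sum_congr rfl fun j _ => ?_
      rw [hi]
      rfl
    · refine Finset.sum_congr rfl fun j _ => Finset.sum_congr rfl fun l _ => ?_
      rw [AlternatingMap.compLinearMap_apply]
      congr 2
      funext q
      cases q using Fin.cases with
      | zero => simp
      | succ q => rfl

theorem differential_compAlternatingMap (f : M →ₗ[k] N) (hf : ∀ (x : 𝔤) m, f ⁅x, m⁆ = ⁅x, f m⁆)
    {n : ℕ} (ω : 𝔤 [⋀^Fin n]→ₗ[k] M) :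
    differential k k 𝔤 N n (f.compAlternatingMap ω) =
      f.compAlternatingMap (differential k k 𝔤 M n ω) := by
  ext v
  rw [LinearMap.compAlternatingMap_apply, differential_apply, differential_apply]
  cases n with
  | zero => rw [differentialAux, differentialAux, hf]; rfl
  | succ n =>
    rw [differentialAux, differentialAux]
    simp [map_sum, hf]

end Functoriality

end LieAlgebraCohomology

end LieRinehart

namespace LieRinehart

/-! ### Weights on a free Lie algebra and cochains that vanish up to a weight -/

section Truncation

variable {k S : Type*} [CommRing k]

/-- The elements of weight at most `p` of the free Lie algebra on a weighted set. -/
inductive WeightLE (w : S → ℕ) : ℕ → FreeLieAlgebra k S → Prop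
  | of {p : ℕ} (s : S) (h : w s ≤ p) : WeightLE w p (FreeLieAlgebra.of k s)
  | zero (p : ℕ) : WeightLE w p 0
  | add {p : ℕ} {x y : FreeLieAlgebra k S} :
      WeightLE w p x → WeightLE w p y → WeightLE w p (x + y)
  | smul {p : ℕ} (c : k) {x : FreeLieAlgebra k S} : WeightLE w p x → WeightLE w p (c • x)
  | lie {p q r : ℕ} {x y : FreeLieAlgebra k S} (h : p + q ≤ r) :
      WeightLE w p x → WeightLE w q y → WeightLE w r ⁅x, y⁆

theorem WeightLE.mono {w : S → ℕ} {p q : ℕ} {x : FreeLieAlgebra k S} (h : WeightLE w p x)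
    (hpq : p ≤ q) : WeightLE w q x := by
  induction h generalizing q with
  | of s h => exact .of s (h.trans hpq)
  | zero p => exact .zero q
  | add _ _ hx hy => exact .add (hx hpq) (hy hpq)
  | smul c _ hx => exact .smul c (hx hpq)
  | lie h hx hy _ _ => exact .lie (h.trans hpq) hx hy

theorem WeightLE.eq_zero {w : S → ℕ} {p j : ℕ} {x : FreeLieAlgebra k S} (h : WeightLE w p x)
    (hw : ∀ s, j ≤ w s) (hp : p < j) : x = 0 := by
  induction h with
  | of s h => exact absurd (hw s) (by omega)
  | zero p => rfl
  | add _ _ hx hy => rw [hx hp, hy hp, add_zero]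
  | smul c _ hx => rw [hx hp, smul_zero]
  | lie h _ _ hx hy => rw [hx (by omega), zero_lie]

/-- An expression of `x` involves finitely many generators. The weights of the others stay
unconstrained, which later allows them to be made too heavy to matter. -/
theorem exists_finset_weightLE (x : FreeLieAlgebra k S) :
    ∃ (F : Finset S) (p : ℕ), ∀ w : S → ℕ, (∀ s ∈ F, w s = 1) → WeightLE w p x := by
  classical
  induction x using FreeLieAlgebra.induction with
  | of s => exact ⟨{s}, 1, fun w hw => .of s (hw s (by simp)).le⟩
  | zero => exact ⟨∅, 0, fun w _ => .zero 0⟩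
  | add x y hx hy =>
    obtain ⟨F, p, h⟩ := hx
    obtain ⟨G, q, h'⟩ := hy
    exact ⟨F ∪ G, p + q, fun w hw => .add
      ((h w fun s hs => hw s (Finset.mem_union_left _ hs)).mono (Nat.le_add_right _ _))
      ((h' w fun s hs => hw s (Finset.mem_union_right _ hs)).mono (Nat.le_add_left _ _))⟩
  | smul c x hx =>
    obtain ⟨F, p, h⟩ := hx
    exact ⟨F, p, fun w hw => .smul c (h w hw)⟩
  | lie x y hx hy =>
    obtain ⟨F, p, h⟩ := hx
    obtain ⟨G, q, h'⟩ := hy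
    exact ⟨F ∪ G, p + q, fun w hw => .lie le_rfl
      (h w fun s hs => hw s (Finset.mem_union_left _ hs))
      (h' w fun s hs => hw s (Finset.mem_union_right _ hs))⟩

variable {M : Type*} [AddCommGroup M] [Module k M]

/-- An alternating map vanishes up to weight `d` if it vanishes on all tuples of elements whose
weights add up to at most `d`. -/
def VanishesUpTo (w : S → ℕ) : {n : ℕ} → ℕ → (FreeLieAlgebra k S [⋀^Fin n]→ₗ[k] M) → Prop
  | 0, _, ω => ω = 0
  | _ + 1, d, ω => ∀ p e x, p + e ≤ d → WeightLE w p x → VanishesUpTo w e (ω.curryLeft x)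

namespace VanishesUpTo

variable {w : S → ℕ} {n d e : ℕ} {ω η : FreeLieAlgebra k S [⋀^Fin n]→ₗ[k] M}

theorem add (hω : VanishesUpTo w d ω) (hη : VanishesUpTo w d η) : VanishesUpTo w d (ω + η) := by
  induction n generalizing d with
  | zero => exact (congrArg₂ (· + ·) hω hη).trans (add_zero 0)
  | succ n ih => exact fun p e x h hx => ih (hω p e x h hx) (hη p e x h hx)

theorem neg (hω : VanishesUpTo w d ω) : VanishesUpTo w d (-ω) := by
  induction n generalizing d with
  | zero => exact (congrArg (- ·) hω).trans neg_zero
  | succ n ih => exact fun p e x h hx => ih (hω p e x h hx)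

theorem sub (hω : VanishesUpTo w d ω) (hη : VanishesUpTo w d η) : VanishesUpTo w d (ω - η) := by
  rw [sub_eq_add_neg]
  exact hω.add hη.neg

theorem smul (c : k) (hω : VanishesUpTo w d ω) : VanishesUpTo w d (c • ω) := by
  induction n generalizing d with
  | zero => exact (congrArg (c • ·) hω).trans (smul_zero c)
  | succ n ih => exact fun p e x h hx => ih (hω p e x h hx)

theorem zero : VanishesUpTo w d (0 : FreeLieAlgebra k S [⋀^Fin n]→ₗ[k] M) := by
  induction n generalizing d with
  | zero => rfl
  | succ n ih => exact fun p e x h hx => ih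

theorem mono (hω : VanishesUpTo w d ω) (h : e ≤ d) : VanishesUpTo w e ω := by
  cases n with
  | zero => exact hω
  | succ n => exact fun p e x h' hx => hω p e x (h'.trans h) hx

theorem apply_eq_zero (hω : VanishesUpTo w d ω) (v : Fin n → FreeLieAlgebra k S) (p : Fin n → ℕ)
    (hv : ∀ i, WeightLE w (p i) (v i)) (hp : ∑ i, p i ≤ d) : ω v = 0 := by
  induction n generalizing d with
  | zero => rw [show ω = 0 from hω]; rfl
  | succ n ih =>
    rw [Fin.sum_univ_succ] at hp
    rw [← Fin.cons_self_tail v]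
    exact ih (hω (p 0) (∑ i : Fin n, p i.succ) (v 0) hp (hv 0)) (Fin.tail v) (fun i => p i.succ)
      (fun i => hv i.succ) le_rfl

end VanishesUpTo

section Elimination

open FreeLieAlgebra

variable (w : S → ℕ) (t : S)

/-- The weights of the generators left after eliminating a generator. -/
def elimWeight (x : Eliminated t) : ℕ := w x.2.1 + x.1 * w t

variable {w t}

theorem WeightLE.elim {p : ℕ} {y : FreeLieAlgebra k (Eliminated t)}
    (h : WeightLE (elimWeight w t) p y) : WeightLE w p (elim k t y) := by
  induction h with
  | of s h =>
    refine WeightLE.mono ?_ h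
    obtain ⟨j, s⟩ := s
    clear h
    rw [elim_of]
    dsimp only [elimWeight]
    induction j with
    | zero => exact .of _ (Nat.le_add_right _ _)
    | succ j ih =>
      rw [pow_succ', Module.End.mul_apply, LieAlgebra.ad_apply]
      exact .lie (le_of_eq (by ring)) (.of t le_rfl) ih
  | zero p => rw [map_zero]; exact .zero p
  | add _ _ hx hy => rw [map_add]; exact .add hx hy
  | smul c _ hx => rw [map_smul]; exact .smul c hx
  | lie h _ _ hx hy => rw [LieHom.map_lie]; exact .lie h hx hy

theorem WeightLE.shift {p : ℕ} {y : FreeLieAlgebra k (Eliminated t)}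
    (h : WeightLE (elimWeight w t) p y) : WeightLE (elimWeight w t) (p + w t) (shift k t y) := by
  induction h with
  | of s h =>
    obtain ⟨j, s⟩ := s
    rw [shift_of]
    refine .of _ ?_
    dsimp only [elimWeight] at h ⊢
    rw [add_mul, one_mul]
    omega
  | zero p => rw [map_zero]; exact .zero _
  | add _ _ hx hy => rw [map_add]; exact .add hx hy
  | smul c _ hx => rw [map_smul]; exact .smul c hx
  | lie h hx hy hx' hy' =>
    rw [LieDerivation.apply_lie_eq_add]
    exact .add (.lie (by omega) hx hy') (.lie (by omega) hx' hy)

/-- The decomposition `𝔥 ⊕ k t` respects weights: `t` can occur only if its own weight fits under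
the bound. In a bracket, `⁅t, y'⁆` becomes `shift y'`, and the cost `w t` of the shift is paid by
the factor that contained `t`. -/
theorem WeightLE.exists_eq_add {p : ℕ} {x : FreeLieAlgebra k S} (h : WeightLE w p x) :
    ∃ (y : FreeLieAlgebra k (Eliminated t)) (c : k), WeightLE (elimWeight w t) p y ∧
      (c = 0 ∨ w t ≤ p) ∧ x = FreeLieAlgebra.elim k t y + c • FreeLieAlgebra.of k t := by
  induction h with
  | of s h =>
    by_cases hs : s = t
    · exact ⟨0, 1, .zero _, .inr (hs ▸ h), by simp [hs]⟩
    · exact ⟨FreeLieAlgebra.of k (0, ⟨s, hs⟩), 0, .of _ (by simpa [elimWeight] using h),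
        .inl rfl, by simp [elim_of]⟩
  | zero p => exact ⟨0, 0, .zero _, .inl rfl, by simp⟩
  | add _ _ hx hx' =>
    obtain ⟨y, c, hy, hc, rfl⟩ := hx
    obtain ⟨y', c', hy', hc', rfl⟩ := hx'
    refine ⟨y + y', c + c', .add hy hy', ?_, by rw [map_add]; module⟩
    rcases hc with rfl | hc
    · rcases hc' with rfl | hc'
      · exact .inl (add_zero 0)
      · exact .inr hc'
    · exact .inr hc
  | smul a _ hx =>
    obtain ⟨y, c, hy, hc, rfl⟩ := hx
    refine ⟨a • y, a • c, .smul a hy, ?_, by rw [map_smul]; module⟩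
    rcases hc with rfl | hc
    · exact .inl (smul_zero a)
    · exact .inr hc
  | @lie p q r _ _ h _ _ hx hx' =>
    obtain ⟨y, c, hy, hc, rfl⟩ := hx
    obtain ⟨y', c', hy', hc', rfl⟩ := hx'
    have h1 : WeightLE (elimWeight w t) r (c • FreeLieAlgebra.shift k t y') := by
      rcases hc with rfl | hc
      · rw [zero_smul]; exact .zero r
      · exact .smul c (hy'.shift.mono (by omega))
    have h2 : WeightLE (elimWeight w t) r (c' • FreeLieAlgebra.shift k t y) := by
      rcases hc' with rfl | hc'
      · rw [zero_smul]; exact .zero r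
      · exact .smul c' (hy.shift.mono (by omega))
    refine ⟨⁅y, y'⁆ + c • FreeLieAlgebra.shift k t y' + (-1 : k) • c' • FreeLieAlgebra.shift k t y,
      0, .add (.add (.lie h hy hy') h1) (.smul _ h2), .inl rfl, ?_⟩
    simp only [map_add, map_smul, elim_shift, LieHom.map_lie, add_lie, lie_add, smul_lie,
      lie_smul, lie_self, ← lie_skew (FreeLieAlgebra.elim k t y) (FreeLieAlgebra.of k t)]
    module

variable {n d e : ℕ}

theorem VanishesUpTo.comp_elim {ω : FreeLieAlgebra k S [⋀^Fin n]→ₗ[k] M}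
    (h : VanishesUpTo w d ω) :
    VanishesUpTo (elimWeight w t) d (ω.compLinearMap (FreeLieAlgebra.elim k t).toLinearMap) := by
  induction n generalizing d with
  | zero =>
    rw [show ω = 0 from h]
    exact VanishesUpTo.zero
  | succ n ih =>
    intro p e x hpe hx
    rw [AlternatingMap.curryLeft_compLinearMap]
    exact ih (h p e _ hpe hx.elim)

/-- An alternating map on `𝔥 ⊕ k t` is determined by its restriction to `𝔥` and by the restriction
to `𝔥` of its contraction with `t`, since `t` can be fed only once. Feeding `t` uses up weight `w
t`; the condition `e + w t ≤ d` expresses this without subtraction in `ℕ`. -/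
theorem vanishesUpTo_of_comp_elim {ω : FreeLieAlgebra k S [⋀^Fin (n + 1)]→ₗ[k] M}
    (h : VanishesUpTo (elimWeight w t) d
      (ω.compLinearMap (FreeLieAlgebra.elim k t).toLinearMap))
    (h' : ∀ e, e + w t ≤ d → VanishesUpTo (elimWeight w t) e
      ((ω.curryLeft (of k t)).compLinearMap (FreeLieAlgebra.elim k t).toLinearMap)) :
    VanishesUpTo w d ω := by
  induction n generalizing d with
  | zero =>
    intro p e x hpe hx
    obtain ⟨y, c, hy, hc, rfl⟩ := hx.exists_eq_add (t := t)
    have h1 := h p e y hpe hy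
    rw [AlternatingMap.curryLeft_compLinearMap] at h1
    have h0 (η : FreeLieAlgebra k S [⋀^Fin 0]→ₗ[k] M) (hη :
        η.compLinearMap (FreeLieAlgebra.elim k t).toLinearMap = 0) : η = 0 := by
      ext v
      exact (congrArg η (Subsingleton.elim _ _)).trans (DFunLike.congr_fun hη ![])
    rw [map_add, map_smul]
    refine VanishesUpTo.add (h0 _ h1) ?_
    rcases hc with rfl | hc
    · rw [zero_smul]; exact .zero
    -- In degree 0, vanishing does not depend on the bound, so the bound 0 suffices.
    · exact .smul c (h0 _ (h' 0 (by omega)))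
  | succ n ih =>
    intro p e x hpe hx
    obtain ⟨y, c, hy, hc, rfl⟩ := hx.exists_eq_add (t := t)
    rw [map_add, map_smul]
    refine VanishesUpTo.add (ih ?_ fun e' he' => ?_) ?_
    · have := h p e y hpe hy
      rwa [AlternatingMap.curryLeft_compLinearMap] at this
    -- The hypothesis controls contraction with `t` first and `y` second; the goal has the opposite
    -- order, at the cost of a sign.
    · have := (h' (p + e') (by omega)) p e' y le_rfl hy
      rw [AlternatingMap.curryLeft_compLinearMap] at this
      rw [curryLeft_curryLeft]
      exact this.neg
    · rcases hc with rfl | hc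
      · rw [zero_smul]; exact .zero
      · refine .smul c (ih (h' e (by omega)) fun e' he' => ?_)
        rw [AlternatingMap.curryLeft_same]
        exact VanishesUpTo.zero

end Elimination

end Truncation

end LieRinehart

namespace LieRinehart

/-! ### Exactness up to a weight, by elimination of generators -/

section TruncatedCohomology

open FreeLieAlgebra

attribute [local instance] trivialLieRingModule lieRinehartRing_trivial lieRinehartAlgebra_trivial
  representation_trivial

universe u v

variable {k : Type*} {S : Type u} [CommRing k]

section OneCochains

variable {𝔤 M : Type*} [LieRing 𝔤] [LieAlgebra k 𝔤] [AddCommGroup M] [Module k M]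
  [LieRingModule 𝔤 M] [LieModule k 𝔤 M]

theorem curryLeft_curryLeft_differential {n : ℕ} (ω : 𝔤 [⋀^Fin (n + 1)]→ₗ[k] M) (x y : 𝔤)
    (hx : ω.curryLeft x = 0) (hy : ω.curryLeft y = 0) :
    ((differential k k 𝔤 M (n + 1) ω).curryLeft x).curryLeft y = -ω.curryLeft ⁅x, y⁆ := by
  rw [differential_curryLeft, hx, map_zero, sub_zero, lieDerivative_curryLeft, hy]
  have : lieDerivative x (0 : 𝔤 [⋀^Fin n]→ₗ[k] M) = 0 := by
    ext v
    simp [lieDerivative_apply]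
  rw [this, zero_sub]

theorem differential_ofSubsingleton_lieDerivation (D : LieDerivation k 𝔤 M) :
    differential k k 𝔤 M 1 (AlternatingMap.ofSubsingleton k 𝔤 M 0 D) = 0 := by
  let ω : 𝔤 [⋀^Fin 1]→ₗ[k] M := AlternatingMap.ofSubsingleton k 𝔤 M 0 D
  have h0 (v : Fin 1 → 𝔤) : ω v = D (v 0) := rfl
  have h1 (z : 𝔤) (u : Fin 0 → 𝔤) : ω.curryLeft z u = D z := rfl
  refine ext_curryLeft fun x => ?_
  change (differential k k 𝔤 M 1 ω).curryLeft x = 0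
  rw [differential_curryLeft]
  ext v
  rw [AlternatingMap.sub_apply, lieDerivative_apply, differential_apply, differentialAux, h1,
    Fin.sum_univ_one, h0, h0]
  simp [LieDerivation.apply_lie_eq_sub]

end OneCochains

section Vanishing

variable {M : Type*} [AddCommGroup M] [Module k M] [LieRingModule (FreeLieAlgebra k S) M]
  [LieModule k (FreeLieAlgebra k S) M] {w : S → ℕ}

/-- If `ω` vanishes at `x` and `y`, then `dω(x, y) = -ω([x, y])`; so vanishing spreads from the
generators to all brackets of weight at most `d`. -/
theorem vanishesUpTo_of_generators {d : ℕ} {ω : FreeLieAlgebra k S [⋀^Fin 1]→ₗ[k] M}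
    (hω : ∀ s, ω.curryLeft (of k s) = 0) (hd : VanishesUpTo w d (differential k k _ M 1 ω)) :
    VanishesUpTo w d ω := by
  have key (p : ℕ) (x : FreeLieAlgebra k S) (hx : WeightLE w p x) (hp : p ≤ d) :
      ω.curryLeft x = 0 := by
    induction hx with
    | of s h => exact hω s
    | zero p => exact map_zero _
    | add _ _ hx hy => rw [map_add, hx hp, hy hp, add_zero]
    | smul c _ hx => rw [map_smul, hx hp, smul_zero]
    | @lie p q r x y h hpx hqy hx hy =>
      have h1 : ((differential k k _ M 1 ω).curryLeft x).curryLeft y = 0 :=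
        hd p q x (by omega) hpx q 0 y le_rfl hqy
      rw [curryLeft_curryLeft_differential ω x y (hx (by omega)) (hy (by omega))] at h1
      exact neg_eq_zero.mp h1
  exact fun p e x h hx => key p x hx (by omega)

variable {t : S}

theorem comp_elim_lieDerivative_eq_zero {n : ℕ} {ω : FreeLieAlgebra k S [⋀^Fin n]→ₗ[k] M}
    (h : ω.compLinearMap (elim k t).toLinearMap = 0) :
    (lieDerivative (of k t) ω).compLinearMap (elim k t).toLinearMap = 0 := by
  ext v
  have hv (v) : ω (elim k t ∘ v) = 0 := DFunLike.congr_fun h v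
  change lieDerivative (of k t) ω (elim k t ∘ v) = 0
  rw [lieDerivative_apply, hv, lie_zero, zero_sub, neg_eq_zero]
  refine Finset.sum_eq_zero fun j _ => ?_
  rw [Function.comp_apply, ← elim_shift, ← Function.comp_update, hv]

/-- The Lie derivative along `t` evaluates `ω` at `[t, y]`, which stays in the image of `elim` but
weighs `w t` more. This is the loss from `d` to `e`. -/
theorem VanishesUpTo.comp_elim_lieDerivative {n d e : ℕ}
    {ω : FreeLieAlgebra k S [⋀^Fin n]→ₗ[k] M} (hde : e + w t ≤ d)
    (h : VanishesUpTo (elimWeight w t) d (ω.compLinearMap (elim k t).toLinearMap)) :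
    VanishesUpTo (elimWeight w t) e
      ((lieDerivative (of k t) ω).compLinearMap (elim k t).toLinearMap) := by
  induction n generalizing d e with
  | zero => exact comp_elim_lieDerivative_eq_zero h
  | succ n ih =>
    intro p e' y hpe hy
    rw [AlternatingMap.curryLeft_compLinearMap]
    change VanishesUpTo _ _ (((lieDerivative (of k t) ω).curryLeft (elim k t y)).compLinearMap _)
    rw [lieDerivative_curryLeft, ← elim_shift]
    change VanishesUpTo _ _ ((lieDerivative (of k t) (ω.curryLeft (elim k t y))).compLinearMap
      (elim k t).toLinearMap -
        (ω.curryLeft (elim k t (shift k t y))).compLinearMap (elim k t).toLinearMap)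
    refine VanishesUpTo.sub (ih (d := e' + w t) le_rfl ?_) ?_
    · have := h p (e' + w t) y (by omega) hy
      rwa [AlternatingMap.curryLeft_compLinearMap] at this
    · have := h (p + w t) e' (shift k t y) (by omega) hy.shift
      rwa [AlternatingMap.curryLeft_compLinearMap] at this

end Vanishing

/-- Every cochain of degree `n + 1` which is a cocycle up to weight `d` is a coboundary up to
weight `d`. -/
def TruncatedExact (k : Type*) [CommRing k] {S : Type u} (w : S → ℕ) (d n : ℕ) : Prop :=
  ∀ (M : Type v) [AddCommGroup M] [Module k M] [LieRingModule (FreeLieAlgebra k S) M]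
    [LieModule k (FreeLieAlgebra k S) M] (ω : FreeLieAlgebra k S [⋀^Fin (n + 1)]→ₗ[k] M),
    VanishesUpTo w d (differential k k _ M (n + 1) ω) →
      ∃ η, VanishesUpTo w d (ω - differential k k _ M n η)

section Step

variable {w : S → ℕ} {t : S} {M : Type v} [AddCommGroup M] [Module k M]
  [LieRingModule (FreeLieAlgebra k S) M] [LieModule k (FreeLieAlgebra k S) M]
  [LieRingModule (FreeLieAlgebra k (Eliminated t)) M]
  [LieModule k (FreeLieAlgebra k (Eliminated t)) M]

/-- The degree 1 case, where `θ` need not be a coboundary. A derivation `D` of `𝔥`, extended by zero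
at `t`, gives `ζ` with `ι_t dζ = L_t ζ`, so the equation to solve is `t D(y) - D([t, y]) = θ(y)`.
Since `[t, ·]` moves the free generator `(j, s)` of `𝔥` to `(j + 1, s)`, it can be solved
recursively in `j`. -/
theorem exists_transgression_one
    (hM : ∀ (y : FreeLieAlgebra k (Eliminated t)) (m : M), ⁅y, m⁆ = ⁅elim k t y, m⁆) {e : ℕ}
    (θ : FreeLieAlgebra k (Eliminated t) [⋀^Fin 1]→ₗ[k] M)
    (hθ : VanishesUpTo (elimWeight w t) e (differential k k _ M 1 θ)) :
    ∃ ζ : FreeLieAlgebra k S [⋀^Fin 1]→ₗ[k] M,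
      (differential k k _ M 1 ζ).compLinearMap (elim k t).toLinearMap = 0 ∧
      VanishesUpTo (elimWeight w t) e (θ - ((differential k k _ M 1 ζ).curryLeft
        (of k t)).compLinearMap (elim k t).toLinearMap) := by
  obtain ⟨p, -, hp, -, hpt, -⟩ := exists_retraction k t
  let f (s : {s : S // s ≠ t}) (j : ℕ) : M :=
    -- The value at `j = 0` is arbitrary; the next value is forced by the equation at `(j, s)`.
    j.rec 0 fun j m => ⁅of k t, m⁆ - θ ![of k (j, s)]
  obtain ⟨D, hD⟩ := exists_lieDerivation (k := k) fun x : Eliminated t => f x.2 x.1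
  let ζ : FreeLieAlgebra k S [⋀^Fin 1]→ₗ[k] M :=
    AlternatingMap.ofSubsingleton k _ M 0 ((D : FreeLieAlgebra k (Eliminated t) →ₗ[k] M) ∘ₗ p)
  have hζ : ζ.compLinearMap (elim k t).toLinearMap =
      AlternatingMap.ofSubsingleton k _ M 0 (D : FreeLieAlgebra k (Eliminated t) →ₗ[k] M) := by
    ext v
    change D (p (elim k t (v 0))) = D (v 0)
    rw [hp]
  have hd : (differential k k _ M 1 ζ).compLinearMap (elim k t).toLinearMap = 0 := by
    rw [← differential_compLinearMap _ hM, hζ, differential_ofSubsingleton_lieDerivation]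
  have ht : ζ.curryLeft (of k t) = 0 := by
    ext v
    change D (p (of k t)) = 0
    rw [hpt, map_zero]
  refine ⟨ζ, hd, vanishesUpTo_of_generators (fun s => ?_) ?_⟩
  · obtain ⟨j, s⟩ := s
    have hcurry (η θ : FreeLieAlgebra k (Eliminated t) [⋀^Fin 1]→ₗ[k] M) (x) :
      (η - θ).curryLeft x = η.curryLeft x - θ.curryLeft x := rfl
    rw [hcurry, sub_eq_zero, differential_curryLeft, ht, map_zero, sub_zero]
    ext v
    have hv : v = ![] := Subsingleton.elim _ _
    subst hv
    change θ ![of k (j, s)] =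
      lieDerivative (of k t) ζ (elim k t ∘ (Matrix.vecCons (of k (j, s)) ![]))
    have h (x : Fin 1 → FreeLieAlgebra k S) : ζ x = D (p (x 0)) := rfl
    rw [lieDerivative_apply, Fin.sum_univ_one, h, h, Function.update_self, Function.comp_apply,
      Matrix.cons_val_zero, ← elim_shift, hp, hp, shift_of, hD, hD]
    change _ = ⁅of k t, f s j⁆ - (⁅of k t, f s j⁆ - θ ![of k (j, s)])
    abel
  -- By Cartan's formula and `d² = 0`, `d(ι_t dζ) = L_t dζ`, which vanishes on `𝔥` because `dζ` does
  -- and `𝔥` is stable under `ad(t)`. Hence the difference is a cocycle up to weight `e`, and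
  -- comparing on generators is enough.
  · rw [map_sub]
    refine hθ.sub ?_
    rw [differential_compLinearMap _ hM]
    have h := differential_curryLeft (k := k) (differential k k _ M 1 ζ) (of k t)
    rw [differential_differential] at h
    have h' : differential k k _ M 1 ((differential k k _ M 1 ζ).curryLeft (of k t)) =
        lieDerivative (of k t) (differential k k _ M 1 ζ) := (sub_eq_zero.mp h.symm).symm
    rw [h', comp_elim_lieDerivative_eq_zero hd]
    exact VanishesUpTo.zero

/-- In higher degree `θ` is already `dη` on `𝔥` up to weight `e`. The cochain `ζ = c ∧ η` vanishes
on `𝔥` and contracts with `t` to `η`, so Cartan's formula gives `ι_t dζ = -dη` on `𝔥`. This accounts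
for the sign in the witness `-ζ`. -/
theorem exists_transgression_succ
    (hM : ∀ (y : FreeLieAlgebra k (Eliminated t)) (m : M), ⁅y, m⁆ = ⁅elim k t y, m⁆) {n e : ℕ}
    (hT : TruncatedExact.{u, v} k (elimWeight w t) e n)
    (θ : FreeLieAlgebra k (Eliminated t) [⋀^Fin (n + 1)]→ₗ[k] M)
    (hθ : VanishesUpTo (elimWeight w t) e (differential k k _ M (n + 1) θ)) :
    ∃ ζ : FreeLieAlgebra k S [⋀^Fin (n + 1)]→ₗ[k] M,
      (differential k k _ M (n + 1) ζ).compLinearMap (elim k t).toLinearMap = 0 ∧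
      VanishesUpTo (elimWeight w t) e (θ - ((differential k k _ M (n + 1) ζ).curryLeft
        (of k t)).compLinearMap (elim k t).toLinearMap) := by
  obtain ⟨p, c, hp, hc, -, hct, -⟩ := exists_retraction k t
  obtain ⟨η, hη⟩ := hT M θ hθ
  have hpη : (η.compLinearMap p).compLinearMap (elim k t).toLinearMap = η := by
    ext v
    exact congrArg η (funext fun i => hp (v i))
  let ζ := wedge c (η.compLinearMap p)
  have hζ : ζ.compLinearMap (elim k t).toLinearMap = 0 := compLinearMap_wedge _ c hc _
  have hd : (differential k k _ M (n + 1) ζ).compLinearMap (elim k t).toLinearMap = 0 := by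
    rw [← differential_compLinearMap _ hM, hζ, map_zero]
  refine ⟨-ζ, ?_, ?_⟩
  · rw [map_neg]
    exact neg_eq_zero.mpr hd
  · have h : ((differential k k _ M (n + 1) (-ζ)).curryLeft (of k t)).compLinearMap
        (elim k t).toLinearMap = differential k k _ M n η := by
      have h1 := differential_curryLeft (k := k) ζ (of k t)
      have h2 : (differential k k _ M n (ζ.curryLeft (of k t))).compLinearMap
          (elim k t).toLinearMap = differential k k _ M n η := by
        rw [← differential_compLinearMap _ hM, compLinearMap_curryLeft_wedge _ c hc hct, hpη]
      have h3 := comp_elim_lieDerivative_eq_zero hζ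
      rw [map_neg]
      change -((differential k k _ M (n + 1) ζ).curryLeft (of k t)).compLinearMap
        (elim k t).toLinearMap = _
      rw [h1]
      change -((lieDerivative (of k t) ζ).compLinearMap (elim k t).toLinearMap -
        (differential k k _ M n (ζ.curryLeft (of k t))).compLinearMap
          (elim k t).toLinearMap) = _
      rw [h2, h3, zero_sub, neg_neg]
    rw [h]
    exact hη

end Step

/-- One elimination step, a hands-on Hochschild–Serre argument for the ideal `𝔥`. Exactness for `𝔥`
in the degree of `ω` makes `ω` vanish on `𝔥`; the contraction with `t` is then a cocycle of one
degree less on `𝔥`, to be removed by a transgression. The hypothesis in the lower degree is needed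
only when that degree is at least 2. -/
theorem truncatedExact_of_eliminated {w : S → ℕ} (t : S) {d n : ℕ}
    (hT : TruncatedExact.{u, v} k (elimWeight w t) d (n + 1))
    (hT' : ∀ m, n = m + 1 → ∀ e ≤ d, TruncatedExact.{u, v} k (elimWeight w t) e n) :
    TruncatedExact.{u, v} k w d (n + 1) := by
  intro M _ _ _ _ ω hω
  let _ : LieRingModule (FreeLieAlgebra k (Eliminated t)) M :=
    LieRingModule.compLieHom M (elim k t)
  have : LieModule k (FreeLieAlgebra k (Eliminated t)) M := LieModule.compLieHom M (elim k t)
  have hM (y : FreeLieAlgebra k (Eliminated t)) (m : M) : ⁅y, m⁆ = ⁅elim k t y, m⁆ := rfl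
  obtain ⟨p, -, hp, -⟩ := exists_retraction k t
  obtain ⟨η, hη⟩ := hT M (ω.compLinearMap (elim k t).toLinearMap) (by
    rw [differential_compLinearMap _ hM]
    exact hω.comp_elim)
  have hpη : (η.compLinearMap p).compLinearMap (elim k t).toLinearMap = η := by
    ext v
    exact congrArg η (funext fun i => hp (v i))
  -- The primitive on `𝔥` is extended along the linear projection `p`; the result vanishes on `𝔥` up
  -- to weight `d`.
  let ω₁ := ω - differential k k _ M (n + 1) (η.compLinearMap p)
  have hsub {m : ℕ} (α β : FreeLieAlgebra k S [⋀^Fin m]→ₗ[k] M) :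
      (α - β).compLinearMap (elim k t).toLinearMap =
        α.compLinearMap (elim k t).toLinearMap - β.compLinearMap (elim k t).toLinearMap := rfl
  have hcurry (α β : FreeLieAlgebra k S [⋀^Fin (n + 2)]→ₗ[k] M) (x) :
      (α - β).curryLeft x = α.curryLeft x - β.curryLeft x := rfl
  have h₁ : VanishesUpTo (elimWeight w t) d (ω₁.compLinearMap (elim k t).toLinearMap) := by
    rw [hsub, ← differential_compLinearMap _ hM, hpη]
    exact hη
  have hd₁ : VanishesUpTo w d (differential k k _ M (n + 2) ω₁) := by
    rw [map_sub, differential_differential, sub_zero]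
    exact hω
  by_cases ht : w t ≤ d
  · obtain ⟨e, rfl⟩ := Nat.exists_eq_add_of_le' ht
    let θ := (ω₁.curryLeft (of k t)).compLinearMap (elim k t).toLinearMap
    have hθ : VanishesUpTo (elimWeight w t) e (differential k k _ M (n + 1) θ) := by
      -- `d(ι_t ω₁) = L_t ω₁ - ι_t dω₁`. On `𝔥` both terms vanish up to weight `d - w t`.
      have h := differential_curryLeft (k := k) ω₁ (of k t)
      have h' : differential k k _ M (n + 1) (ω₁.curryLeft (of k t)) =
          lieDerivative (of k t) ω₁ - (differential k k _ M (n + 2) ω₁).curryLeft (of k t) := by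
        rw [h]; abel
      rw [differential_compLinearMap _ hM, h', hsub]
      exact (h₁.comp_elim_lieDerivative le_rfl).sub
        (hd₁ (w t) e (of k t) (by omega) (.of t le_rfl)).comp_elim
    have hX : ∃ ζ : FreeLieAlgebra k S [⋀^Fin (n + 1)]→ₗ[k] M,
        (differential k k _ M (n + 1) ζ).compLinearMap (elim k t).toLinearMap = 0 ∧
        VanishesUpTo (elimWeight w t) e (θ - ((differential k k _ M (n + 1) ζ).curryLeft
          (of k t)).compLinearMap (elim k t).toLinearMap) := by
      cases n with
      | zero => exact exists_transgression_one hM θ hθ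
      | succ m => exact exists_transgression_succ hM (hT' m rfl e (by omega)) θ hθ
    obtain ⟨ζ, hζ, hζ'⟩ := hX
    refine ⟨η.compLinearMap p + ζ, ?_⟩
    rw [map_add, ← sub_sub]
    refine vanishesUpTo_of_comp_elim (t := t) ?_ fun e' he' => ?_
    · rw [hsub, hζ, sub_zero]
      exact h₁
    · rw [hcurry, hsub]
      exact hζ'.mono (by omega)
  -- If `t` is heavier than `d`, the contraction with `t` is subject to no condition.
  · exact ⟨η.compLinearMap p, vanishesUpTo_of_comp_elim (t := t) h₁ fun e' he' => by omega⟩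

theorem truncatedExact_of_le {w : S → ℕ} {d n : ℕ} (hw : ∀ s, d + 1 ≤ w s) :
    TruncatedExact.{u, v} k w d n := by
  intro M _ _ _ _ ω _
  refine ⟨0, fun p e x h hx => ?_⟩
  rw [hx.eq_zero hw (by omega), map_zero]
  exact VanishesUpTo.zero

theorem finite_elimWeight {w : S → ℕ} (t : S) (ht : 1 ≤ w t) {d : ℕ}
    (hw : ∀ m ≤ d, {s | w s = m}.Finite) (m : ℕ) (hm : m ≤ d) :
    {x | elimWeight w t x = m}.Finite := by
  have h : {s | w s ≤ m}.Finite := by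
    refine ((Set.finite_Iic m).biUnion fun l (hl : l ≤ m) => hw l (hl.trans hm)).subset ?_
    intro s hs
    exact Set.mem_biUnion (show w s ∈ Set.Iic m from hs) rfl
  refine ((Set.finite_Iic m).prod (h.preimage Subtype.val_injective.injOn)).subset ?_
  rintro ⟨j, s⟩ hx
  have hx' : w s.1 + j * w t = m := hx
  have hj : j ≤ j * w t := Nat.le_mul_of_pos_right j ht
  exact ⟨show j ≤ m by omega, show w s.1 ≤ m by omega⟩

/-- When `t` has least weight, `ad(t)ʲ(s)` has that weight only for `j = 0`. The surviving
generators of least weight are therefore among the old ones, with `t` removed. -/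
theorem ncard_elimWeight_lt {w : S → ℕ} {t : S} (ht : 1 ≤ w t) (hw : ∀ s, w t ≤ w s)
    (hfin : {s | w s = w t}.Finite) :
    {x | elimWeight w t x = w t}.ncard < {s | w s = w t}.ncard := by
  have h (x : Eliminated t) (hx : elimWeight w t x = w t) : x.1 = 0 ∧ w x.2.1 = w t := by
    have hx' : w x.2.1 + x.1 * w t = w t := hx
    have h1 := hw x.2.1
    have h2 : x.1 * w t = 0 := by omega
    exact ⟨(Nat.mul_eq_zero.mp h2).resolve_right (by omega), by omega⟩
  have hinj : Set.InjOn (fun x : Eliminated t => x.2.1) {x | elimWeight w t x = w t} := by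
    intro x hx y hy hxy
    exact Prod.ext ((h x hx).1.trans (h y hy).1.symm) (Subtype.ext hxy)
  rw [← hinj.ncard_image]
  refine Set.ncard_lt_ncard ((Set.ssubset_iff_of_subset ?_).mpr ⟨t, rfl, ?_⟩) hfin
  · rintro _ ⟨x, hx, rfl⟩
    exact (h x hx).2
  · rintro ⟨x, -, hx⟩
    exact x.2.2 hx

/-- Double induction: on the gap `r` between the lower bound `j` of the weights and `d + 1`, and
within it on the number of generators of weight exactly `j`. Eliminating one of these lowers their
number; when none is left, `j` increases. At `j = d + 1` no nonzero element has weight at most `d`.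
-/
theorem truncatedExact_of_pred {n d : ℕ}
    (hn : ∀ m, n = m + 1 → ∀ (S : Type u) (w : S → ℕ), (∀ s, 1 ≤ w s) → ∀ e ≤ d,
      (∀ m ≤ e, {s | w s = m}.Finite) → TruncatedExact.{u, v} k w e n)
    (r j : ℕ) (hr : j + r = d + 1) (hj : 1 ≤ j) (w : S → ℕ) (hwj : ∀ s, j ≤ w s)
    (hw : ∀ m ≤ d, {s | w s = m}.Finite) : TruncatedExact.{u, v} k w d (n + 1) := by
  induction r generalizing S j with
  | zero => exact truncatedExact_of_le fun s => by have := hwj s; omega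
  | succ r ih =>
    induction hc : {s | w s = j}.ncard using Nat.strong_induction_on generalizing S with
    | h c ihc =>
      by_cases hex : ∃ t, w t = j
      · obtain ⟨t, rfl⟩ := hex
        have hfin := finite_elimWeight t hj hw
        have hle (x : Eliminated t) : w t ≤ elimWeight w t x :=
          (hwj x.2.1).trans (Nat.le_add_right _ _)
        refine truncatedExact_of_eliminated t ?_ fun m hm e he => ?_
        · exact ihc _ (hc ▸ ncard_elimWeight_lt hj hwj (hw _ (by omega))) _ hle hfin rfl
        · exact hn m hm _ _ (fun x => hj.trans (hle x)) e he fun m hm => hfin m (hm.trans he)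
      · push Not at hex
        exact ih (j + 1) (by omega) (by omega) w
          (fun s => lt_of_le_of_ne (hwj s) (hex s).symm) hw

/-- The Chevalley–Eilenberg complex of a free Lie algebra is exact up to any given weight in degrees
at least `2`, if there are finitely many generators of each weight. -/
theorem truncatedExact {n : ℕ} {w : S → ℕ} {d : ℕ} (hw : ∀ s, 1 ≤ w s)
    (hfin : ∀ m ≤ d, {s | w s = m}.Finite) : TruncatedExact.{u, v} k w d (n + 1) := by
  induction n generalizing S d with
  | zero =>
    exact truncatedExact_of_pred (fun m hm => by omega) d 1 (add_comm _ _) le_rfl w hw hfin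
  | succ n ih =>
    exact truncatedExact_of_pred (fun m hm S w hw e he hfin => ih hw hfin) d 1 (add_comm _ _)
      le_rfl w hw hfin

end TruncatedCohomology

end LieRinehart

namespace LieRinehart

/-! ### From finite sets of tuples to dual coefficients, and dimension shifting -/

section FreeLieAlgebraCohomology

open FreeLieAlgebra

attribute [local instance] trivialLieRingModule lieRinehartRing_trivial lieRinehartAlgebra_trivial
  representation_trivial

/-- A system of linear equations over a field whose unknown is a linear form is solvable if all its
finite subsystems are. -/
theorem exists_dual_of_finset {k X Q : Type*} [Field k] [AddCommGroup Q] [Module k Q] (Ψ : X → Q)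
    (c : X → k) (h : ∀ F : Finset X, ∃ φ : Q →ₗ[k] k, ∀ x ∈ F, φ (Ψ x) = c x) :
    ∃ φ : Q →ₗ[k] k, ∀ x, φ (Ψ x) = c x := by
  -- Over a field, solvability means that `c` respects every linear relation among the `Ψ x`. A
  -- relation has finite support, so a solution of one finite subsystem checks it.
  have hc : Finsupp.linearCombination k c ∈
      LinearMap.range (Finsupp.linearCombination k Ψ).dualMap := by
    rw [LinearMap.range_dualMap_eq_dualAnnihilator_ker, Submodule.mem_dualAnnihilator]
    intro z hz
    obtain ⟨φ, hφ⟩ := h z.support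
    have h1 : φ (Finsupp.linearCombination k Ψ z) = 0 := by rw [LinearMap.mem_ker.mp hz, map_zero]
    rw [← h1, Finsupp.linearCombination_apply, Finsupp.linearCombination_apply, Finsupp.sum,
      Finsupp.sum, map_sum]
    exact Finset.sum_congr rfl fun x hx => by rw [map_smul, hφ x hx]
  obtain ⟨φ, hφ⟩ := hc
  refine ⟨φ, fun x => ?_⟩
  have := LinearMap.congr_fun hφ (Finsupp.single x 1)
  simpa using this

section DualCoefficients

variable {k 𝔤 N D : Type*} [Field k] [LieRing 𝔤] [LieAlgebra k 𝔤] [AddCommGroup N] [Module k N]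
  [AddCommGroup D] [Module k D] (ev : D ≃ₗ[k] Module.Dual k N)

/-- The linear form on `⋀ⁿ 𝔤 ⊗ N` given by a cochain with values in the dual of `N`. -/
noncomputable def cochainPairing {n : ℕ} (η : 𝔤 [⋀^Fin n]→ₗ[k] D) : (⋀[k]^n 𝔤) ⊗[k] N →ₗ[k] k :=
  TensorProduct.lift (ev.toLinearMap ∘ₗ exteriorPower.alternatingMapLinearEquiv η)

theorem cochainPairing_tmul {n : ℕ} (η : 𝔤 [⋀^Fin n]→ₗ[k] D) (v : Fin n → 𝔤) (m : N) :
    cochainPairing ev η (exteriorPower.ιMulti k n v ⊗ₜ m) = ev (η v) m := by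
  rw [cochainPairing, TensorProduct.lift.tmul, LinearMap.comp_apply,
    exteriorPower.alternatingMapLinearEquiv_apply_ιMulti]
  rfl

theorem cochainPairing_surjective {n : ℕ} (φ : (⋀[k]^n 𝔤) ⊗[k] N →ₗ[k] k) :
    ∃ η : 𝔤 [⋀^Fin n]→ₗ[k] D, cochainPairing ev η = φ := by
  refine ⟨exteriorPower.alternatingMapLinearEquiv.symm
    (ev.symm.toLinearMap ∘ₗ TensorProduct.curry φ), ?_⟩
  refine TensorProduct.ext' fun x m => ?_
  simp [cochainPairing]

/-- With dual coefficients the differential is the transpose of the Chevalley–Eilenberg boundary;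
`z` is the boundary of `v ⊗ m`. The minus sign in `-⁅v i, m⁆` is that of the contragredient action.
-/
theorem exists_boundary [LieRingModule 𝔤 N] [LieModule k 𝔤 N] [LieRingModule 𝔤 D]
    [LieModule k 𝔤 D] (hev : ∀ (x : 𝔤) (f : D) (m : N), ev ⁅x, f⁆ m = -ev f ⁅x, m⁆) {n : ℕ}
    (v : Fin (n + 2) → 𝔤) (m : N) : ∃ z : (⋀[k]^(n + 1) 𝔤) ⊗[k] N,
      ∀ η : 𝔤 [⋀^Fin (n + 1)]→ₗ[k] D,
        cochainPairing ev η z = ev (differential k k 𝔤 D (n + 1) η v) m := by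
  refine ⟨∑ i : Fin (n + 2), (-1 : ℤ) ^ (i : ℕ) •
      exteriorPower.ιMulti k (n + 1) (i.removeNth v) ⊗ₜ[k] (-⁅v i, m⁆) +
    ∑ j : Fin (n + 2), ∑ i : Fin (n + 1) with i.castSucc < j, (-1 : ℤ) ^ ((i : ℕ) + (j : ℕ)) •
      exteriorPower.ιMulti k (n + 1)
        (Fin.cons ⁅v i.castSucc, v j⁆ (i.removeNth (j.removeNth v))) ⊗ₜ[k] m, fun η => ?_⟩
  rw [differential_apply, differentialAux]
  simp only [map_add, map_sum, map_zsmul, map_neg, cochainPairing_tmul, LinearMap.add_apply,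
    LinearMap.sum_apply, LinearMap.smul_apply, hev]

end DualCoefficients

section FreeLie

universe u v

variable {k : Type*} {S : Type u} [Field k]

theorem exists_primitive_finset {D : Type v} [AddCommGroup D] [Module k D]
    [LieRingModule (FreeLieAlgebra k S) D] [LieModule k (FreeLieAlgebra k S) D] {n : ℕ}
    (ω : FreeLieAlgebra k S [⋀^Fin (n + 2)]→ₗ[k] D) (hω : differential k k _ D (n + 2) ω = 0)
    (F : Finset (Fin (n + 2) → FreeLieAlgebra k S)) :
    ∃ η, ∀ v ∈ F, differential k k _ D (n + 1) η v = ω v := by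
  classical
  choose G p hp using exists_finset_weightLE (k := k) (S := S)
  let T := F.biUnion fun v => Finset.univ.biUnion fun i => G (v i)
  let d := ∑ v ∈ F, ∑ i, p (v i)
  -- The generators occurring in `F` get weight 1 and all others a weight beyond `d`. So finitely
  -- many generators have weight at most `d`, while `d` bounds the total weight of every tuple in
  -- `F`.
  let w (s : S) := if s ∈ T then 1 else d + 1
  have hw (s : S) : 1 ≤ w s := by
    dsimp only [w]
    split_ifs <;> omega
  have hfin (m : ℕ) (hm : m ≤ d) : {s | w s = m}.Finite := by
    refine T.finite_toSet.subset fun s hs => ?_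
    by_contra hsT
    have h1 : w s = d + 1 := if_neg hsT
    have h2 : w s = m := hs
    omega
  obtain ⟨η, hη⟩ := truncatedExact.{u, v} hw hfin D ω (by rw [hω]; exact VanishesUpTo.zero)
  refine ⟨η, fun v hv => ?_⟩
  have h := hη.apply_eq_zero v (fun i => p (v i)) (fun i => hp _ w fun s hs => if_pos ?_)
    (Finset.single_le_sum (f := fun v => ∑ i, p (v i)) (fun _ _ => Nat.zero_le _) hv)
  · exact (sub_eq_zero.mp h).symm
  · exact Finset.mem_biUnion.mpr ⟨v, hv, Finset.mem_biUnion.mpr ⟨i, Finset.mem_univ i, hs⟩⟩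

/-- Cochains with values in `D` are the linear forms on `⋀ 𝔤 ⊗ N`, and `dη = ω` prescribes the value
of such a form on each boundary `z`. Every finite subsystem involves finitely many tuples and is
solvable by `exists_primitive_finset`. -/
theorem exists_primitive_dual {N D : Type*} [AddCommGroup N] [Module k N]
    [LieRingModule (FreeLieAlgebra k S) N] [LieModule k (FreeLieAlgebra k S) N] [AddCommGroup D]
    [Module k D] [LieRingModule (FreeLieAlgebra k S) D] [LieModule k (FreeLieAlgebra k S) D]
    (ev : D ≃ₗ[k] Module.Dual k N)
    (hev : ∀ (x : FreeLieAlgebra k S) (f : D) (m : N), ev ⁅x, f⁆ m = -ev f ⁅x, m⁆) {n : ℕ}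
    (ω : FreeLieAlgebra k S [⋀^Fin (n + 2)]→ₗ[k] D) (hω : differential k k _ D (n + 2) ω = 0) :
    ∃ η, differential k k _ D (n + 1) η = ω := by
  classical
  choose z hz using fun x : (Fin (n + 2) → FreeLieAlgebra k S) × N =>
    exists_boundary ev hev x.1 x.2
  obtain ⟨φ, hφ⟩ := exists_dual_of_finset z (fun x => ev (ω x.1) x.2) fun F => by
    obtain ⟨η, hη⟩ := exists_primitive_finset ω hω (F.image Prod.fst)
    refine ⟨cochainPairing ev η, fun x hx => ?_⟩
    rw [hz, hη _ (Finset.mem_image_of_mem _ hx)]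
  obtain ⟨η, rfl⟩ := cochainPairing_surjective ev φ
  refine ⟨η, AlternatingMap.ext fun v => ev.injective (LinearMap.ext fun m => ?_)⟩
  rw [← hφ (v, m), hz]

theorem eq_zero_of_generators {M : Type*} [AddCommGroup M] [Module k M]
    [LieRingModule (FreeLieAlgebra k S) M] [LieModule k (FreeLieAlgebra k S) M]
    {ω : FreeLieAlgebra k S [⋀^Fin 1]→ₗ[k] M} (hω : differential k k _ M 1 ω = 0)
    (h : ∀ s, ω.curryLeft (of k s) = 0) : ω = 0 := by
  refine ext_curryLeft fun x => ?_
  obtain ⟨F, p, hx⟩ := exists_finset_weightLE x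
  have hv : VanishesUpTo (fun _ => 1) p ω :=
    vanishesUpTo_of_generators h (by rw [hω]; exact VanishesUpTo.zero)
  exact hv p 0 x le_rfl (hx _ fun _ _ => rfl)

/-- Vanishing of the cohomology of a free Lie algebra in degree `n + 1`. -/
def ExactAt (k : Type*) [Field k] (S : Type u) (n : ℕ) : Prop :=
  ∀ (M : Type v) [AddCommGroup M] [Module k M] [LieRingModule (FreeLieAlgebra k S) M]
    [LieModule k (FreeLieAlgebra k S) M] (ω : FreeLieAlgebra k S [⋀^Fin (n + 1)]→ₗ[k] M),
    differential k k _ M (n + 1) ω = 0 → ∃ η, differential k k _ M n η = ω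

section Shift

variable {M D Q : Type*} [AddCommGroup M] [Module k M]
  [LieRingModule (FreeLieAlgebra k S) M] [LieModule k (FreeLieAlgebra k S) M] [AddCommGroup D]
  [Module k D] [LieRingModule (FreeLieAlgebra k S) D] [LieModule k (FreeLieAlgebra k S) D]
  [AddCommGroup Q] [Module k Q] [LieRingModule (FreeLieAlgebra k S) Q]
  [LieModule k (FreeLieAlgebra k S) Q]

/-- A 1-cocycle is a derivation, which lifts because its values on the generators can be lifted
freely. In higher degree the cocycle is a coboundary `dζ`, and `ζ` lifts through a linear section of
`q`, which need not be equivariant. -/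
theorem exists_cocycle_lift (q : D →ₗ[k] Q) (hq : ∀ (x : FreeLieAlgebra k S) m, q ⁅x, m⁆ = ⁅x, q m⁆)
    (hsurj : Function.Surjective q) {n : ℕ}
    (hQ : ∀ m, n = m + 1 → ∀ ω : FreeLieAlgebra k S [⋀^Fin (n + 1)]→ₗ[k] Q,
      differential k k _ Q (n + 1) ω = 0 → ∃ η, differential k k _ Q n η = ω)
    (θ : FreeLieAlgebra k S [⋀^Fin (n + 1)]→ₗ[k] Q) (hθ : differential k k _ Q (n + 1) θ = 0) :
    ∃ κ : FreeLieAlgebra k S [⋀^Fin (n + 1)]→ₗ[k] D,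
      differential k k _ D (n + 1) κ = 0 ∧ q.compAlternatingMap κ = θ := by
  obtain ⟨σ, hσ⟩ := q.exists_rightInverse_of_surjective (LinearMap.range_eq_top.mpr hsurj)
  have hσ' (y : Q) : q (σ y) = y := LinearMap.congr_fun hσ y
  cases n with
  | zero =>
    obtain ⟨E, hE⟩ := exists_lieDerivation (k := k) fun s => σ (θ ![of k s])
    refine ⟨AlternatingMap.ofSubsingleton k _ D (0 : Fin 1) (E : FreeLieAlgebra k S →ₗ[k] D),
      differential_ofSubsingleton_lieDerivation E, ?_⟩
    refine sub_eq_zero.mp (eq_zero_of_generators ?_ fun s => ?_)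
    · rw [map_sub, differential_compAlternatingMap q hq,
        differential_ofSubsingleton_lieDerivation, hθ, sub_zero]
      exact LinearMap.compAlternatingMap_zero q
    · refine AlternatingMap.ext fun v => ?_
      have hv : v = ![] := Subsingleton.elim _ _
      subst hv
      change q (E (of k s)) - θ ![of k s] = 0
      rw [hE, hσ', sub_self]
  | succ n =>
    obtain ⟨ζ, rfl⟩ := hQ n rfl θ hθ
    refine ⟨differential k k _ D (n + 1) (σ.compAlternatingMap ζ), differential_differential k _ _,
      ?_⟩
    rw [← differential_compAlternatingMap q hq]
    congr 1
    ext v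
    exact hσ' _

/-- The connecting map of the long exact sequence, chased by hand: if `iω = dη`, then `qη` is a
cocycle. Subtracting from `η` a cocycle `κ` that lifts `qη` leaves a primitive with values in `M`.
-/
theorem exists_primitive_of_embedding (i : M →ₗ[k] D) (q : D →ₗ[k] Q)
    (hi : ∀ (x : FreeLieAlgebra k S) m, i ⁅x, m⁆ = ⁅x, i m⁆)
    (hq : ∀ (x : FreeLieAlgebra k S) m, q ⁅x, m⁆ = ⁅x, q m⁆) (hinj : Function.Injective i)
    (hsurj : Function.Surjective q) (hexact : Function.Exact i q) {n : ℕ}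
    (hD : ∀ ω : FreeLieAlgebra k S [⋀^Fin (n + 2)]→ₗ[k] D,
      differential k k _ D (n + 2) ω = 0 → ∃ η, differential k k _ D (n + 1) η = ω)
    (hQ : ∀ m, n = m + 1 → ∀ ω : FreeLieAlgebra k S [⋀^Fin (n + 1)]→ₗ[k] Q,
      differential k k _ Q (n + 1) ω = 0 → ∃ η, differential k k _ Q n η = ω)
    (ω : FreeLieAlgebra k S [⋀^Fin (n + 2)]→ₗ[k] M) (hω : differential k k _ M (n + 2) ω = 0) :
    ∃ η, differential k k _ M (n + 1) η = ω := by
  obtain ⟨r, hr⟩ := i.exists_leftInverse_of_injective (LinearMap.ker_eq_bot.mpr hinj)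
  have hr' (m : M) : r (i m) = m := LinearMap.congr_fun hr m
  obtain ⟨η, hη⟩ := hD (i.compAlternatingMap ω) (by
    rw [differential_compAlternatingMap i hi, hω]
    exact LinearMap.compAlternatingMap_zero i)
  obtain ⟨κ, hκ, hqκ⟩ := exists_cocycle_lift q hq hsurj hQ (q.compAlternatingMap η) (by
    rw [differential_compAlternatingMap q hq, hη]
    ext v
    exact hexact.apply_apply_eq_zero _)
  have hir : i.compAlternatingMap (r.compAlternatingMap (η - κ)) = η - κ := by
    ext v
    obtain ⟨m, hm⟩ := (hexact ((η - κ) v)).mp (by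
      rw [AlternatingMap.sub_apply, map_sub, sub_eq_zero]
      exact (DFunLike.congr_fun hqκ v).symm)
    change i (r ((η - κ) v)) = (η - κ) v
    rw [← hm, hr']
  refine ⟨r.compAlternatingMap (η - κ), AlternatingMap.ext fun v => hinj ?_⟩
  have h := differential_compAlternatingMap i hi (r.compAlternatingMap (η - κ))
  rw [hir, map_sub, hη, hκ, sub_zero] at h
  exact (DFunLike.congr_fun h v).symm

end Shift

end FreeLie

end FreeLieAlgebraCohomology

/-! ### Arbitrary coefficients, through the bidual -/

section BidualEmbedding

universe u v x

variable {k : Type x} {S : Type u} [Field k]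

theorem exists_bidual_embedding {𝔤 : Type u} [LieRing 𝔤] [LieAlgebra k 𝔤] (M : Type v)
    [AddCommGroup M] [Module k M] [LieRingModule 𝔤 M] [LieModule k 𝔤 M] :
    ∃ (N D Q : Type (max v x)) (_ : AddCommGroup N) (_ : Module k N) (_ : LieRingModule 𝔤 N)
      (_ : LieModule k 𝔤 N) (_ : AddCommGroup D) (_ : Module k D) (_ : LieRingModule 𝔤 D)
      (_ : LieModule k 𝔤 D) (_ : AddCommGroup Q) (_ : Module k Q) (_ : LieRingModule 𝔤 Q)
      (_ : LieModule k 𝔤 Q) (ev : D ≃ₗ[k] Module.Dual k N) (i : M →ₗ[k] D) (q : D →ₗ[k] Q),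
      (∀ (x : 𝔤) (f : D) (m : N), ev ⁅x, f⁆ m = -ev f ⁅x, m⁆) ∧
      (∀ (x : 𝔤) m, i ⁅x, m⁆ = ⁅x, i m⁆) ∧ (∀ (x : 𝔤) m, q ⁅x, m⁆ = ⁅x, q m⁆) ∧
      Function.Injective i ∧ Function.Surjective q ∧ Function.Exact i q := by
  let i : M →ₗ⁅k, 𝔤⁆ Module.Dual k (Module.Dual k M) :=
    { Module.Dual.eval k M with
      map_lie' := fun {x m} => by
        ext f
        change f ⁅x, m⁆ = -(⁅x, f⁆ m)
        rw [Module.Dual.lie_apply, neg_neg] }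
  refine ⟨Module.Dual k M, Module.Dual k (Module.Dual k M),
    Module.Dual k (Module.Dual k M) ⧸ i.range, inferInstance, inferInstance, inferInstance,
    inferInstance, inferInstance, inferInstance, inferInstance, inferInstance, inferInstance,
    inferInstance, inferInstance, inferInstance, LinearEquiv.refl _ _, i,
    LieSubmodule.Quotient.mk' i.range, fun x f m => rfl, fun x m => i.map_lie x m,
    fun x m => LieModuleHom.map_lie _ x m, ?_, ?_, ?_⟩
  · exact Module.eval_apply_injective k
  · exact LieSubmodule.Quotient.surjective_mk' i.range
  · intro y
    rw [LieModuleHom.coe_toLinearMap, LieSubmodule.Quotient.mk'_apply,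
      LieSubmodule.Quotient.mk_eq_zero']
    exact LieModuleHom.mem_range i y

theorem exactAt_of_shift {n : ℕ} (hn : ∀ m, n = m + 1 → ExactAt.{u, max v x} k S n) :
    ExactAt.{u, v} k S (n + 1) := by
  intro M _ _ _ _ ω hω
  obtain ⟨N, D, Q, _, _, _, _, _, _, _, _, _, _, _, _, ev, i, q, hev, hi, hq, hinj, hsurj, hex⟩ :=
    exists_bidual_embedding (k := k) (𝔤 := FreeLieAlgebra k S) M
  exact exists_primitive_of_embedding i q hi hq hinj hsurj hex
    (fun ω hω => exists_primitive_dual ev hev ω hω) (fun m hm => hn m hm Q) ω hω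

/-- Passing to the bidual raises the universe `v` to `max v x`. The induction on the degree is run
in `max v x`, which is stable under this operation; one further shift then treats `v`. -/
theorem exactAt_max (n : ℕ) : ExactAt.{u, max v x} k S (n + 1) := by
  induction n with
  | zero => exact exactAt_of_shift.{u, max v x, x} fun m hm => by omega
  | succ n ih => exact exactAt_of_shift.{u, max v x, x} fun m hm => ih

/-- The cohomology of a free Lie algebra over a field vanishes in degrees at least `2`. -/
theorem exactAt (n : ℕ) : ExactAt.{u, v} k S (n + 1) :=
  exactAt_of_shift fun m hm => by
    subst hm
    exact exactAt_max m

end BidualEmbedding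

end LieRinehart

namespace LieRinehart

/-! ### Comparison of cochains of `A ⊗ 𝔤` with cochains of `𝔤` -/

section Restriction

variable {k A 𝔤 M : Type*} [CommRing k] [CommRing A] [Algebra k A] [LieRing 𝔤] [LieAlgebra k 𝔤]
  {ρ : 𝔤 →ₗ⁅k⁆ Derivation k A A}

namespace Transformation

variable (ρ) in
/-- The inclusion `ξ ↦ 1 ⊗ ξ` of a Lie algebra into its transformation Lie–Rinehart algebra. -/
noncomputable def incl : 𝔤 →ₗ⁅k⁆ Transformation ρ where
  toFun ξ := tmul ρ 1 ξ
  map_add' ξ η := TensorProduct.tmul_add (1 : A) ξ η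
  map_smul' c ξ := TensorProduct.tmul_smul c (1 : A) ξ
  map_lie' {ξ η} := (tmul_one_lie_tmul_one ρ ξ η).symm

theorem induction_smul {P : Transformation ρ → Prop} (x : Transformation ρ) (zero : P 0)
    (smul : ∀ (α : A) ξ, P (α • incl ρ ξ)) (add : ∀ x y, P x → P y → P (x + y)) : P x := by
  refine Transformation.induction ρ x zero (fun α ξ => ?_) add
  have h := smul α ξ
  change P (α • tmul ρ 1 ξ) at h
  rwa [smul_tmul, mul_one] at h

theorem linearMap_ext {N : Type*} [AddCommGroup N] [Module A N] {f g : Transformation ρ →ₗ[A] N}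
    (h : ∀ ξ, f (incl ρ ξ) = g (incl ρ ξ)) : f = g := by
  ext x
  induction x using induction_smul with
  | zero => rw [map_zero, map_zero]
  | smul α ξ => rw [map_smul, map_smul, h]
  | add x y hx hy => rw [map_add, map_add, hx, hy]

theorem exists_linearMap {N : Type*} [AddCommGroup N] [Module k N] [Module A N]
    [IsScalarTower k A N] (f : 𝔤 →ₗ[k] N) :
    ∃ F : Transformation ρ →ₗ[A] N, ∀ ξ, F (incl ρ ξ) = f ξ :=
  ⟨f.liftBaseChange A, fun ξ => by
    change f.liftBaseChange A (1 ⊗ₜ ξ) = _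
    simp⟩

end Transformation

open Transformation

variable [AddCommGroup M] [Module k M] [Module A M] [IsScalarTower k A M]

/-- The restriction of a cochain of `A ⊗ 𝔤` to `𝔤`. -/
noncomputable def restrict {n : ℕ} :
    (Transformation ρ [⋀^Fin n]→ₗ[A] M) →ₗ[k] 𝔤 [⋀^Fin n]→ₗ[k] M where
  toFun ω :=
    { ω.toMultilinearMap.restrictScalars k with
      map_eq_zero_of_eq' := ω.map_eq_zero_of_eq : Transformation ρ [⋀^Fin n]→ₗ[k] M }.compLinearMap
        (incl ρ : 𝔤 →ₗ[k] Transformation ρ)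
  map_add' _ _ := rfl
  map_smul' _ _ := rfl

theorem restrict_apply {n : ℕ} (ω : Transformation ρ [⋀^Fin n]→ₗ[A] M) (v : Fin n → 𝔤) :
    restrict (k := k) ω v = ω (fun i => incl ρ (v i)) := rfl

theorem restrict_curryLeft {n : ℕ} (ω : Transformation ρ [⋀^Fin (n + 1)]→ₗ[A] M) (ξ : 𝔤) :
    restrict (k := k) (ω.curryLeft (incl ρ ξ)) = (restrict ω).curryLeft ξ := by
  ext v
  change ω _ = ω _
  congr 1
  funext i
  cases i using Fin.cases <;> rfl

variable [LieRingModule (Transformation ρ) M] [Representation A (Transformation ρ) M]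

theorem restrict_injective {n : ℕ} : Function.Injective
    (restrict : (Transformation ρ [⋀^Fin n]→ₗ[A] M) →ₗ[k] 𝔤 [⋀^Fin n]→ₗ[k] M) := by
  induction n with
  | zero =>
    intro ω η h
    ext v
    have := congrArg (fun θ => θ ![]) h
    simp only [restrict_apply] at this
    rwa [Subsingleton.elim v fun i => incl ρ ((![] : Fin 0 → 𝔤) i)]
  | succ n ih =>
    intro ω η h
    have : ω.curryLeft = η.curryLeft := linearMap_ext fun ξ => ih <| by
      rw [restrict_curryLeft, restrict_curryLeft, h]
    exact ext_curryLeft fun x => by rw [this]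

/-- Induction on the degree: the contractions of `η` extend by hypothesis, depend linearly on `ξ`,
and extend `A`-linearly to a map `F` on `A ⊗ 𝔤`. It remains to see that `F` comes from an
alternating map. -/
theorem restrict_surjective {n : ℕ} : Function.Surjective
    (restrict : (Transformation ρ [⋀^Fin n]→ₗ[A] M) →ₗ[k] 𝔤 [⋀^Fin n]→ₗ[k] M) := by
  induction n with
  | zero =>
    intro η
    refine ⟨AlternatingMap.constOfIsEmpty A (Transformation ρ) (Fin 0) (η ![]), ?_⟩
    ext v
    rw [Subsingleton.elim v ![]]
    rfl
  | succ n ih =>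
    intro η
    let e := LinearEquiv.ofBijective
      (restrict : (Transformation ρ [⋀^Fin n]→ₗ[A] M) →ₗ[k] 𝔤 [⋀^Fin n]→ₗ[k] M)
      ⟨restrict_injective, ih⟩
    have : IsScalarTower k A (Transformation ρ [⋀^Fin n]→ₗ[A] M) :=
      ⟨fun c α ω => AlternatingMap.ext fun v => smul_assoc c α (ω v)⟩
    obtain ⟨F, hF⟩ := exists_linearMap (ρ := ρ) (A := A) (e.symm.toLinearMap ∘ₗ η.curryLeft)
    have hF' (ξ : 𝔤) : restrict (k := k) (F (incl ρ ξ)) = η.curryLeft ξ := by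
      rw [hF]; exact e.apply_symm_apply _
    obtain ⟨D, hD⟩ : ∃ D : Transformation ρ [⋀^Fin (n + 1)]→ₗ[A] M,
        ∀ x y, D (Fin.cons x y) = F x y := by
      cases n with
      | zero =>
        refine ⟨AlternatingMap.ofSubsingleton A _ M (0 : Fin 1)
          { toFun := fun x => F x ![]
            map_add' := fun x y => by rw [map_add]; rfl
            map_smul' := fun α x => by rw [map_smul]; rfl }, fun x y => ?_⟩
        rw [Subsingleton.elim y ![]]
        rfl
      | succ n =>
        have hself (ξ : 𝔤) : (F (incl ρ ξ)).curryLeft (incl ρ ξ) = 0 := by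
          refine restrict_injective (k := k) ?_
          rw [restrict_curryLeft, hF', η.curryLeft_same, map_zero]
        let H : Transformation ρ →ₗ[A] Transformation ρ →ₗ[A] Transformation ρ [⋀^Fin n]→ₗ[A] M :=
          AlternatingMap.curryLeftLinearMap ∘ₗ F
        -- Vanishing on the diagonal is not an additive condition, so it cannot be checked on the
        -- elements `1 ⊗ ξ` alone. Antisymmetry can, since `H` is `A`-bilinear, and it follows there
        -- by polarization; it cancels the cross terms when vanishing is extended to sums.
        have hskew : H = -H.flip := by
          refine linearMap_ext fun ξ => linearMap_ext fun ζ => ?_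
          have h : H (incl ρ (ξ + ζ)) (incl ρ (ξ + ζ)) = 0 := hself _
          have h1 : H (incl ρ ξ) (incl ρ ξ) = 0 := hself _
          have h2 : H (incl ρ ζ) (incl ρ ζ) = 0 := hself _
          simp only [map_add, LinearMap.add_apply, h1, h2, zero_add, add_zero] at h
          rw [LinearMap.neg_apply, LinearMap.neg_apply, LinearMap.flip_apply]
          exact eq_neg_of_add_eq_zero_right h
        have hzero (x : Transformation ρ) : H x x = 0 := by
          induction x using induction_smul with
          | zero => rw [map_zero]
          | smul α ξ =>
            have h1 : H (incl ρ ξ) (incl ρ ξ) = 0 := hself _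
            rw [map_smul, map_smul, LinearMap.smul_apply, h1, smul_zero, smul_zero]
          | add x y hx hy =>
            have h : H x y = -H y x := congrArg (fun G => G x y) hskew
            simp only [map_add, LinearMap.add_apply, hx, hy, h]
            abel
        exact exists_uncurry F fun x z => congrArg (fun θ => θ z) (hzero x)
    refine ⟨D, ?_⟩
    ext v
    rw [restrict_apply, ← Fin.cons_self_tail fun i => incl ρ (v i), hD]
    refine (congrArg (fun θ => θ (Fin.tail v)) (hF' (v 0))).trans ?_
    change η (Fin.cons (v 0) (Fin.tail v)) = η v
    rw [Fin.cons_self_tail]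

variable (k M ρ) in
/-- A representation of the transformation Lie–Rinehart algebra of `𝔤`, viewed as a module
over `𝔤`. -/
@[reducible]
noncomputable def restrictLieRingModule : LieRingModule 𝔤 M where
  bracket ξ m := ⁅incl ρ ξ, m⁆
  add_lie ξ η m := by rw [map_add, add_lie]
  lie_add ξ m m' := lie_add _ m m'
  leibniz_lie ξ η m := by rw [LieHom.map_lie]; exact leibniz_lie _ _ m

theorem restrict_lieModule :
    letI := restrictLieRingModule k M ρ
    LieModule k 𝔤 M :=
  letI := restrictLieRingModule k M ρ
  { smul_lie := fun c ξ m => by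
      change ⁅incl ρ (c • ξ), m⁆ = c • ⁅incl ρ ξ, m⁆
      rw [map_smul, ← algebraMap_smul A c (incl ρ ξ), Representation.smul_lie, algebraMap_smul]
    lie_smul := fun c ξ m => by
      change ⁅incl ρ ξ, c • m⁆ = c • ⁅incl ρ ξ, m⁆
      rw [← algebraMap_smul A c m, Representation.lie_smul, Transformation.lie_algebraMap,
        zero_smul, add_zero, algebraMap_smul] }

attribute [local instance] trivialLieRingModule lieRinehartRing_trivial
  lieRinehartAlgebra_trivial representation_trivial

/-- On elements `1 ⊗ ξ` the anchor terms of the bracket vanish, because derivations kill `1`; so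
both differentials are given by the same formula. -/
theorem differential_restrict [LieRingModule 𝔤 M] [LieModule k 𝔤 M]
    (h : ∀ (ξ : 𝔤) (m : M), ⁅ξ, m⁆ = ⁅incl ρ ξ, m⁆) {n : ℕ}
    (ω : Transformation ρ [⋀^Fin n]→ₗ[A] M) :
    differential k k 𝔤 M n (restrict ω) =
      restrict (differential k A (Transformation ρ) M n ω) := by
  ext v
  rw [restrict_apply, differential_apply, differential_apply]
  cases n with
  | zero =>
    rw [differentialAux, differentialAux, h, restrict_apply]
    congr 2
    exact Subsingleton.elim _ _
  | succ n =>
    rw [differentialAux, differentialAux]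
    congr 1
    · refine Finset.sum_congr rfl fun j _ => ?_
      rw [h]
      rfl
    · refine Finset.sum_congr rfl fun j _ => Finset.sum_congr rfl fun l _ => ?_
      rw [restrict_apply]
      congr 2
      funext q
      cases q using Fin.cases with
      | zero => simp
      | succ q => rfl

end Restriction

attribute [local instance] trivialLieRingModule lieRinehartRing_trivial
  lieRinehartAlgebra_trivial representation_trivial

theorem subsingleton_cohomology {k A S : Type*} [Field k] [CommRing A] [Algebra k A]
    (a : S → Derivation k A A) (M : Type*) [AddCommGroup M] [Module k M] [Module A M]
    [IsScalarTower k A M] [LieRingModule (FreeLieRinehart a) M]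
    [Representation A (FreeLieRinehart a) M] (n : ℕ) :
    Subsingleton (Cohomology k A (FreeLieRinehart a) M (n + 2)) := by
  let := restrictLieRingModule k M (FreeLieAlgebra.lift k a)
  have : LieModule k (FreeLieAlgebra k S) M := restrict_lieModule
  rw [Submodule.Quotient.subsingleton_iff, Submodule.submoduleOf, Submodule.comap_subtype_eq_top]
  intro ω hω
  have hres {m : ℕ} (θ : FreeLieRinehart a [⋀^Fin m]→ₗ[A] M) :
      differential k k _ M m (restrict θ) = restrict (differential k A (FreeLieRinehart a) M m θ) :=
    differential_restrict (fun _ _ => rfl) θ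
  -- A primitive over the free Lie algebra extends to `A ⊗ 𝔤` by surjectivity of `restrict`, and it
  -- is a primitive of `ω` by injectivity.
  obtain ⟨η, hη⟩ := exactAt n M (restrict (k := k) ω) <| by
    rw [hres, LinearMap.mem_ker.mp hω, map_zero]
  obtain ⟨θ, rfl⟩ := restrict_surjective (A := A) (ρ := FreeLieAlgebra.lift k a) η
  exact ⟨θ, restrict_injective ((hres θ).symm.trans hη)⟩

end LieRinehart
theorem mainTheorem5 {k A S : Type*} [Field k] [CommRing A] [Algebra k A]
    (a : S → Derivation k A A) :
    Module.Free (LieRinehart.Enveloping k A (LieRinehart.FreeLieRinehart a))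
      (LieRinehart.augmentationIdeal k A (LieRinehart.FreeLieRinehart a)) ∧
    ∀ (M : Type*) [AddCommGroup M] [Module k M] [Module A M] [IsScalarTower k A M]
      [LieRingModule (LieRinehart.FreeLieRinehart a) M]
      [LieRinehart.Representation A (LieRinehart.FreeLieRinehart a) M] (i : ℕ), 2 ≤ i →
      Subsingleton (LieRinehart.Cohomology k A (LieRinehart.FreeLieRinehart a) M i) := by
  refine ⟨LieRinehart.free_augmentationIdeal a, fun M _ _ _ _ _ _ i hi => ?_⟩
  obtain ⟨n, rfl⟩ := Nat.exists_eq_add_of_le' hi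
  exact LieRinehart.subsingleton_cohomology a M n
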